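/- Let $D$ be a connected (planar, unoriented) link diagram with $n$ crossings, numbered $1,\dots,n$. Every crossing has a $0$-smoothing, which joins the two regions swept out when the upper strand is turned counterclockwise, and a $1$-smoothing, which joins the other two regions. A Kauffman state of $D$ is obtained by smoothing all crossings; it is a disjoint union of circles. For a Kauffman state $S$ let $r(D,S)$ be the number of its $1$-smoothings, and let $\mathcal K_1(D)$ be the set of Kauffman states consisting of exactly one circle. Let $\mathcal T(D)$ be the set of partially smoothed diagrams obtained from $D$ by treating the crossings $1,\dots,n$ in this order, as follows: if both smoothings of the current crossing of a diagram reached so far give connected diagrams, then replace this diagram by these two diagrams; otherwise leave this crossing of it unsmoothed. For a Kauffman state $S$ let $D_S$ be the unique element of $\mathcal T(D)$ which has $S$ among its Kauffman states. For $S\in\mathcal K_1(D)$ let $w(D_S)$ be the number of negative crossings minus the number of positive crossings of $D_S$, with respect to any orientation of $D_S$. Let $\mathcal A=\mathbb Z v_+\oplus\mathbb Z v_-$ with $\deg v_\pm=\pm1$. Let $\mathcal C(D)$ be the (unnormalized) Khovanov complex of $D$ over $\mathbb Z$: as a bigraded module it is $\bigoplus_S\mathcal A^{\otimes k(S)}$,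 the sum being over all Kauffman states $S$, where $k(S)$ is the number of circles of $S$, and where the summand of $S$ has primary degree $r(D,S)$ and its secondary degree is the degree in $\mathcal A^{\otimes k(S)}$ plus $r(D,S)$. The differential has bidegree $(1,0)$. It is the sum, over all ways of changing one $0$-smoothing into a $1$-smoothing, of the maps given by the multiplication $v_+v_+=v_+$, $v_+v_-=v_-v_+=v_-$, $v_-v_-=0$ if two circles merge and by the comultiplication $v_+\mapsto v_+\otimes v_-+v_-\otimes v_+$, $v_-\mapsto v_-\otimes v_-$ if a circle splits, with the sign $(-1)^m$, where $m$ is the number of $1$-smoothings at crossings preceding the changed one. Let $\mathcal H(D)=\bigoplus_{i,j}\mathcal H(D)^{i,j}$ be the homology of $\mathcal C(D)$, with no further shift of the gradings. **Theorem.** For every connected link diagram $D$, $$\dim_{\mathbb Q}\bigl(\mathcal H(D)\otimes\mathbb Q\bigr)\le 2\cdot\#\mathcal K_1(D).$$ Moreover, for all $i,j\in\mathbb Z$, $\dim_{\mathbb Q}\bigl(\mathcal H(D)^{i,j}\otimes\mathbb Q\bigr)$ is at most the number of $S\in\mathcal K_1(D)$ with $$w(D_S)+r(D,S)=i\quad\text{and}\quad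 r(D,S)\in\{2i-j+1,\,2i-j-1\}.$$ -/

import Mathlib

open scoped TensorProduct

noncomputable section

/-- A (planar, unoriented) link diagram with crossings numbered by `Fin n`, given by its planar
diagram code. Every crossing `c` has four ends `(c, 0), (c, 1), (c, 2), (c, 3)`, listed
counterclockwise, such that `(c, 0), (c, 2)` are the ends of the lower strand and
`(c, 1), (c, 3)` are the ends of the upper strand. The involution `edge` tells which ends are
joined by an edge of the projection. Components of the projection which contain no crossing are
simple closed curves; `loops` is their number.

The field `planar` is Euler's formula `V - E + F = 2 C` for the 4-valent graph (with `V = n`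
vertices and `E = 2 n` edges) embedded in the oriented closed surface determined by the cyclic
ordering of the ends at every crossing: it says that every component of this surface is a sphere.
The faces are the orbits of the permutation "go along the edge, then take the next end". -/
structure LinkDiagram where
  n : ℕ
  edge : Fin n × Fin 4 → Fin n × Fin 4
  edge_edge : ∀ e, edge (edge e) = e
  edge_ne : ∀ e, edge e ≠ e
  loops : ℕ
  planar :
    Nat.card (Quot fun e e' : Fin n × Fin 4 => e' = ((edge e).1, (edge e).2 + 1)) =
      n + 2 * Nat.card (Quot fun e e' : Fin n × Fin 4 => e' = edge e ∨ e'.1 = e.1)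

namespace LinkDiagram

/-- The other end of the arc which starts at the end number `k` of a crossing, after this crossing
has been replaced by its 0-smoothing (`b = false`) or its 1-smoothing (`b = true`). The
0-smoothing joins the two regions swept out when the upper strand is turned counterclockwise, i.e.
it is the smoothing which respects the orientations at a positive crossing. -/
def partner (b : Bool) (k : Fin 4) : Fin 4 :=
  if b then ![3, 2, 1, 0] k else ![1, 0, 3, 2] k

variable (D : LinkDiagram)

/-- The ends of the edges at the crossings. -/
abbrev Ends : Type := Fin D.n × Fin 4

/-- A diagram obtained from `D` by smoothing some of the crossings: `none` means that the crossing
is kept, `some false` and `some true` mean that it is replaced by its 0- and 1-smoothing. -/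
abbrev PartialState : Type := Fin D.n → Option Bool

/-- A Kauffman state: all crossings are smoothed. -/
abbrev State : Type := Fin D.n → Bool

variable {D}

/-- A Kauffman state as a diagram obtained by smoothing (all of the) crossings. -/
def State.toPartial (S : D.State) : D.PartialState := fun c => some (S c)

/-- `S` is a Kauffman state of the diagram `σ`. -/
def PartialState.HasState (σ : D.PartialState) (S : D.State) : Prop :=
  ∀ c b, σ c = some b → S c = b

/-- Two ends are adjacent in the diagram `σ` if they are joined by an edge, or by an arc of a
smoothed crossing, or if they belong to the same unsmoothed crossing. -/
def PartialState.Adj (σ : D.PartialState) (e e' : D.Ends) : Prop :=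
  e' = D.edge e ∨ (e'.1 = e.1 ∧ ∀ b, σ e.1 = some b → e'.2 = partner b e.2)

/-- The connected components of the diagram `σ`, regarded as a subset of the plane. -/
abbrev PartialState.Components (σ : D.PartialState) : Type := Quot σ.Adj ⊕ Fin D.loops

/-- The diagram `σ` is connected. -/
def PartialState.IsConnected (σ : D.PartialState) : Prop := Nat.card σ.Components = 1

variable (D) in
/-- The diagram `D` is connected. -/
def IsConnected : Prop := PartialState.IsConnected (fun _ => none : D.PartialState)

/-- The circles of a Kauffman state. -/
abbrev State.Circles (S : D.State) : Type := S.toPartial.Components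

/-- The circle of the Kauffman state `S` running through a given end. -/
def State.circle (S : D.State) (e : D.Ends) : S.Circles := Sum.inl (Quot.mk _ e)

/-- The number `r(D, S)` of 1-smoothings. -/
def State.r (S : D.State) : ℕ := (Finset.univ.filter fun c => S c = true).card

variable (D) in
/-- The set `K₁(D)` of the Kauffman states which consist of exactly one circle. -/
def oneCircleStates : Set D.State := {S | Nat.card S.Circles = 1}

/-! ### The binary tree of partially smoothed diagrams -/

/-- The nodes of the binary tree: `IsNode k σ` means that the diagram `σ` is reached from `D` after
the first `k` crossings have been treated. At each step, the next crossing is smoothed in both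
ways if both resulting diagrams are connected; otherwise it is left as it is. -/
inductive IsNode : ℕ → D.PartialState → Prop
  | root : IsNode 0 (fun _ => none)
  | branch (σ : D.PartialState) (c : Fin D.n) (b : Bool) : IsNode c.val σ →
      (∀ b' : Bool, PartialState.IsConnected (Function.update σ c (some b') : D.PartialState)) →
      IsNode (c.val + 1) (Function.update σ c (some b))
  | keep (σ : D.PartialState) (c : Fin D.n) : IsNode c.val σ →
      ¬ (∀ b' : Bool, PartialState.IsConnected (Function.update σ c (some b') : D.PartialState)) →
      IsNode (c.val + 1) σ

variable (D) in
/-- The set `T(D)` of the diagrams sitting at the leaves of the tree. -/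
def leaves : Set D.PartialState := {σ | IsNode D.n σ}

theorem exists_isNode (S : D.State) (k : ℕ) (hk : k ≤ D.n) :
    ∃ σ : D.PartialState, IsNode k σ ∧ σ.HasState S := by
  induction k with
  | zero => exact ⟨_, IsNode.root, fun c b h => by simp at h⟩
  | succ k ih =>
    obtain ⟨σ, hσ, hS⟩ := ih (by omega)
    let c : Fin D.n := ⟨k, hk⟩
    by_cases h : ∀ b' : Bool,
        PartialState.IsConnected (Function.update σ c (some b') : D.PartialState)
    · refine ⟨_, IsNode.branch σ c (S c) hσ h, fun c' b hb => ?_⟩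
      by_cases hc : c' = c
      · subst hc
        simpa using hb
      · rw [Function.update_of_ne hc] at hb
        exact hS c' b hb
    · exact ⟨σ, IsNode.keep σ c hσ h, hS⟩

theorem hasState_of_update {σ : D.PartialState} {S : D.State} {c : Fin D.n} {b : Bool}
    (hc : σ c = none) (h : PartialState.HasState (Function.update σ c (some b)) S) :
    σ.HasState S ∧ b = S c := by
  refine ⟨fun c' b' hb => ?_, (h c b (by simp)).symm⟩
  by_cases hcc : c' = c
  · subst hcc
    simp [hc] at hb
  · exact h c' b' (by rwa [Function.update_of_ne hcc])

theorem IsNode.eq_none {k : ℕ} {σ : D.PartialState} (h : IsNode k σ) (c : Fin D.n)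
    (hc : k ≤ c.val) : σ c = none := by
  induction h with
  | root => rfl
  | branch σ c' b _ _ ih =>
    have : c ≠ c' := fun e => by subst e; omega
    rw [Function.update_of_ne this]
    exact ih (by omega)
  | keep σ c' _ _ ih => exact ih (by omega)

theorem IsNode.unique {S : D.State} {k : ℕ} {σ : D.PartialState} (h : IsNode k σ) :
    ∀ τ : D.PartialState, IsNode k τ → σ.HasState S → τ.HasState S → σ = τ := by
  induction h with
  | root =>
    intro τ hτ _ _
    funext c
    exact (hτ.eq_none c (Nat.zero_le _)).symm
  | branch σ c b hσ hconn ih =>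
    intro τ hτ h1 h2
    obtain ⟨h1, hb⟩ := hasState_of_update (hσ.eq_none c le_rfl) h1
    generalize hk : c.val + 1 = k at hτ
    cases hτ with
    | root => omega
    | branch τ c' b' hτ hconn' =>
      obtain rfl : c = c' := Fin.ext (by omega)
      obtain ⟨h2, hb'⟩ := hasState_of_update (hτ.eq_none c le_rfl) h2
      rw [ih τ hτ h1 h2, hb, hb']
    | keep _ c' hτ hn =>
      obtain rfl : c = c' := Fin.ext (by omega)
      obtain rfl := ih τ hτ h1 h2
      exact absurd hconn hn
  | keep σ c hσ hn ih =>
    intro τ hτ h1 h2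
    generalize hk : c.val + 1 = k at hτ
    cases hτ with
    | root => omega
    | branch τ c' b' hτ hconn' =>
      obtain rfl : c = c' := Fin.ext (by omega)
      obtain ⟨h2, _⟩ := hasState_of_update (hτ.eq_none c le_rfl) h2
      obtain rfl := ih τ hτ h1 h2
      exact absurd hconn' hn
    | keep _ c' hτ _ =>
      obtain rfl : c = c' := Fin.ext (by omega)
      exact ih τ hτ h1 h2

/-- Every Kauffman state of `D` is a Kauffman state of exactly one leaf of the tree. -/
theorem existsUnique_leaf (S : D.State) :
    ∃! σ : D.PartialState, σ ∈ D.leaves ∧ σ.HasState S := by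
  obtain ⟨σ, h, hS⟩ := exists_isNode S D.n le_rfl
  exact ⟨σ, ⟨h, hS⟩, fun τ hτ => (h.unique τ hτ.1 hS hτ.2).symm⟩

/-- The diagram `D_S`, the unique element of `T(D)` having `S` among its Kauffman states. -/
def State.leaf (S : D.State) : D.PartialState := (existsUnique_leaf S).choose

/-! ### Orientations and the numbers of positive and negative crossings -/

/-- The end opposite to `e` on the strand of the diagram `σ` passing through the crossing or
smoothed crossing at `e`. -/
def PartialState.across (σ : D.PartialState) (e : D.Ends) : D.Ends :=
  (e.1, match σ e.1 with
    | none => e.2 + 2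
    | some b => partner b e.2)

/-- An orientation of the diagram `σ`: `out e` says whether the edge at the end `e` is directed
away from the crossing. (Orientations of components without ends are not recorded, as they are not
involved in any crossing.) -/
structure PartialState.Orientation (σ : D.PartialState) where
  out : D.Ends → Bool
  out_edge : ∀ e, out (D.edge e) ≠ out e
  out_across : ∀ e, out (σ.across e) ≠ out e

theorem PartialState.across_across (σ : D.PartialState) (e : D.Ends) :
    σ.across (σ.across e) = e := by
  obtain ⟨c, k⟩ := e
  unfold PartialState.across
  rcases h : σ c with _ | _ | _ <;> simp <;> revert k <;> decide

theorem PartialState.across_ne (σ : D.PartialState) (e : D.Ends) : σ.across e ≠ e := by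
  obtain ⟨c, k⟩ := e
  unfold PartialState.across
  rcases h : σ c with _ | _ | _ <;> simp <;> revert k <;> decide

/-- Every diagram can be oriented. -/
theorem PartialState.nonempty_orientation (σ : D.PartialState) : Nonempty σ.Orientation := by
  classical
  let e : Equiv.Perm D.Ends := ⟨D.edge, D.edge, D.edge_edge, D.edge_edge⟩
  let t : Equiv.Perm D.Ends := ⟨σ.across, σ.across, σ.across_across, σ.across_across⟩
  have hee : ∀ a, e (e a) = a := D.edge_edge
  have htt : ∀ a, t (t a) = a := σ.across_across
  let p : Equiv.Perm D.Ends := t * e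
  have hp : ∀ a, p (e a) = t a := fun a => by simp [p, hee]
  have hpow : ∀ m : ℕ, ∀ a, (p ^ m) (e ((p ^ m) a)) = e a := by
    intro m
    induction m with
    | zero => intro a; rfl
    | succ m ih =>
      intro a
      have h1 : (p ^ (m + 1)) a = p ((p ^ m) a) := by rw [pow_succ', Equiv.Perm.mul_apply]
      have h2 : p (e (p ((p ^ m) a))) = e ((p ^ m) a) := by rw [hp]; simp [p, htt]
      rw [h1, pow_succ, Equiv.Perm.mul_apply, h2, ih]
  have hne : ∀ a, ¬ p.SameCycle a (e a) := by
    intro a h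
    obtain ⟨m, hm⟩ := h.exists_nat_pow_eq
    rcases Nat.even_or_odd' m with ⟨k, rfl | rfl⟩
    · rw [two_mul, pow_add, Equiv.Perm.mul_apply, ← hpow k a] at hm
      exact D.edge_ne _ ((p ^ k).injective hm).symm
    · have h1 : (p ^ k) (p ((p ^ k) a)) = (p ^ k) (e ((p ^ k) a)) := by
        rw [hpow, ← hm, ← Equiv.Perm.mul_apply, ← Equiv.Perm.mul_apply, ← pow_succ, ← pow_add]
        congr 2
        omega
      have h2 : t (e ((p ^ k) a)) = e ((p ^ k) a) := (p ^ k).injective h1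
      exact σ.across_ne _ h2
  let s := Equiv.Perm.SameCycle.setoid p
  let q : D.Ends → Quotient s := Quotient.mk s
  let lt : Quotient s → Quotient s → Prop := WellOrderingRel
  have hq : ∀ a, q a ≠ q (e a) := fun a h => hne a (Quotient.exact h)
  have hqp : ∀ a, q (p a) = q a := fun a =>
    Quotient.sound (show p.SameCycle (p a) a from (Equiv.Perm.SameCycle.refl p a).apply_left)
  have key : ∀ a b, q b = q (e a) → q (e b) = q a →
      decide (lt (q b) (q (e b))) ≠ decide (lt (q a) (q (e a))) := by
    intro a b h1 h2
    rw [h1, h2]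
    rcases trichotomous_of lt (q a) (q (e a)) with h | h | h
    · simp [h, asymm_of lt h]
    · exact absurd h (hq a)
    · simp [h, asymm_of lt h]
  refine ⟨⟨fun a => decide (lt (q a) (q (e a))), fun a => ?_, fun a => ?_⟩⟩
  · exact key a (e a) rfl (by rw [hee])
  · refine key a (t a) ?_ ?_
    · rw [← hp, hqp]
    · rw [← hqp]
      simp [p, hee, htt]

namespace PartialState.Orientation

variable {σ : D.PartialState} (o : σ.Orientation)

/-- The number `x` of negative crossings of the oriented diagram `σ`. -/
def x : ℕ :=
  (Finset.univ.filter fun c : Fin D.n => σ c = none ∧ o.out (c, 0) = o.out (c, 1)).card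

/-- The number `y` of positive crossings of the oriented diagram `σ`: for instance, the lower
strand goes from end 0 to end 2 and the upper strand goes from end 3 to end 1. -/
def y : ℕ :=
  (Finset.univ.filter fun c : Fin D.n => σ c = none ∧ o.out (c, 0) ≠ o.out (c, 1)).card

/-- The number `w = x - y`. -/
def w : ℤ := (o.x : ℤ) - (o.y : ℤ)

end PartialState.Orientation

/-! ### The Khovanov complex -/

instance (S : D.State) : Fintype S.Circles := Fintype.ofFinite _

variable (D) in
/-- An enhanced Kauffman state: every circle is labelled by one of the two generators of
`𝒜 = ℤ v₊ ⊕ ℤ v₋`, where `true` stands for `v₊` (degree 1) and `false` for `v₋` (degree -1). -/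
structure EnhancedState where
  state : D.State
  label : state.Circles → Bool

instance : Finite D.EnhancedState :=
  Finite.of_injective
    (fun X : D.EnhancedState => (⟨X.state, X.label⟩ : Σ S : D.State, S.Circles → Bool))
    (fun X Y h => by cases X; cases Y; cases h; rfl)

instance : Fintype D.EnhancedState := Fintype.ofFinite _

/-- The coefficient of `v_c` in the product of `v_a` and `v_b`: the generator `v₊` is the unit and
`v₋ v₋ = 0`. -/
def mulCoeff : Bool → Bool → Bool → ℤ
  | true, true, true => 1
  | true, false, false => 1
  | false, true, false => 1
  | _, _, _ => 0

/-- The coefficient of `v_b ⊗ v_c` in the coproduct of `v_a`: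
`v₊ ↦ v₊ ⊗ v₋ + v₋ ⊗ v₊` and `v₋ ↦ v₋ ⊗ v₋`. -/
def comulCoeff : Bool → Bool → Bool → ℤ
  | true, true, false => 1
  | true, false, true => 1
  | false, false, false => 1
  | _, _, _ => 0

namespace EnhancedState

/-- The label of the circle running through the end `e`. -/
def labelAt (X : D.EnhancedState) (e : D.Ends) : Bool := X.label (X.state.circle e)

/-- The primary degree. -/
def deg (X : D.EnhancedState) : ℤ := X.state.r

/-- The secondary degree. -/
def qdeg (X : D.EnhancedState) : ℤ := (∑ C, if X.label C then 1 else -1) + X.state.r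

/-- `Y` results from `X` by changing the 0-smoothing at `c` into the 1-smoothing, and the circles
which do not pass through `c` carry the same labels in `X` and `Y`. -/
def IsStep (X Y : D.EnhancedState) (c : Fin D.n) : Prop :=
  X.state c = false ∧ Y.state = Function.update X.state c true ∧
  (∀ e, X.state.circle e ≠ X.state.circle (c, 0) → X.state.circle e ≠ X.state.circle (c, 2) →
    Y.labelAt e = X.labelAt e) ∧
  ∀ l, Y.label (Sum.inr l) = X.label (Sum.inr l)

open Classical in
/-- The contribution of the circles passing through `c` to the coefficient of `Y` in the
differential of `X`: multiplication if two circles are merged, comultiplication if a circle is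
split. -/
def localCoeff (X Y : D.EnhancedState) (c : Fin D.n) : ℤ :=
  if X.state.circle (c, 0) ≠ X.state.circle (c, 2) ∧
      Y.state.circle (c, 0) = Y.state.circle (c, 2) then
    mulCoeff (X.labelAt (c, 0)) (X.labelAt (c, 2)) (Y.labelAt (c, 0))
  else if X.state.circle (c, 0) = X.state.circle (c, 2) ∧
      Y.state.circle (c, 0) ≠ Y.state.circle (c, 2) then
    comulCoeff (X.labelAt (c, 0)) (Y.labelAt (c, 0)) (Y.labelAt (c, 2))
  else 0

open Classical in
/-- The coefficient of `Y` in the differential of `X`. The sign is determined by the number of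
1-smoothings which precede the changed crossing in the numbering. -/
def coeff (X Y : D.EnhancedState) : ℤ :=
  ∑ c, if IsStep X Y c then
    (-1) ^ (Finset.univ.filter fun c' : Fin D.n => c' < c ∧ X.state c' = true).card *
      localCoeff X Y c
  else 0

end EnhancedState

variable (D)

/-- The module underlying the Khovanov complex `C(D)`: the free abelian group with basis the
enhanced Kauffman states, i.e. the direct sum of the `𝒜^{⊗ k}` over all Kauffman states, where `k`
is the number of circles. -/
abbrev Chain : Type := D.EnhancedState → ℤ

/-- The differential of the Khovanov complex. -/
def d : D.Chain →ₗ[ℤ] D.Chain :=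
  Matrix.mulVecLin (Matrix.of fun Y X => EnhancedState.coeff X Y)

/-- The homogeneous component `C(D)^{i,j}`. -/
def chainAt (i j : ℤ) : Submodule ℤ D.Chain where
  carrier := {f | ∀ X, f X ≠ 0 → X.deg = i ∧ X.qdeg = j}
  add_mem' := by
    intro f g hf hg X hX
    by_cases h : f X = 0
    · exact hg X (fun h' => hX (by simp [h, h']))
    · exact hf X h
  zero_mem' := by
    intro X hX
    simp at hX
  smul_mem' := by
    intro a f hf X hX
    exact hf X (fun h => hX (by simp [h]))

/-- The Khovanov homology `H(D)`, i.e. cycles modulo boundaries. -/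
abbrev Homology : Type :=
  LinearMap.ker D.d ⧸ (LinearMap.range D.d).submoduleOf (LinearMap.ker D.d)

/-- The homogeneous component `H(D)^{i,j}`, consisting of the homology classes of the cycles in
`C(D)^{i,j}`. -/
def homologyAt (i j : ℤ) : Submodule ℤ D.Homology :=
  ((D.chainAt i j).submoduleOf (LinearMap.ker D.d)).map
    ((LinearMap.range D.d).submoduleOf (LinearMap.ker D.d)).mkQ

end LinkDiagram

end

/-!
The homology of a complex of free abelian groups with `N` basis elements has rank `N` minus twice
the rank of the differential, so it suffices to bound the rank of the differential from below. This
is done by a matching of the enhanced Kauffman states: if every source of a matched pair has a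
non-zero coefficient at its mate, and if these coefficients form a triangular matrix for some order
of the pairs, then the rank of the homology, in every bidegree, is at most the number of unmatched
enhanced states (`MatchingBound.finrank_homologyOn_le`). The condition `d ∘ d = 0` is needed for
this.

The matching is built inside the leaves of the tree of partially smoothed diagrams. A crossing which
is left unsmoothed in a leaf is nugatory: one of its smoothings, say the cutting one, disconnects
the diagram (`IsNode.exists_not_rel`). Fix a base end. In a state in which a crossing is cut, this
crossing has a circle on its far side, seen from the base end, and a circle on its near side;
changing the smoothing merges the two. If the cutting smoothing is the 0-smoothing, then the merging
map is an isomorphism on the part where the far circle has the label `v₊`, the unit. If the cutting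
smoothing is the 1-smoothing, then the splitting map is an isomorphism onto the quotient in which
the far circle has the label `v₋`. Thus at every crossing of a leaf two thirds of the complex can be
cancelled, and what remains is the part where the crossing is cut and the far circle has the
opposite label (`IsCritAt`). An enhanced state is matched at the first crossing of its leaf at which
it is not of this remaining kind (`IsPivot`, `mate`).

This matching is triangular (`eq_or_order_lt`). A step of the differential into another leaf
increases the sequence of smoothings chosen along the tree lexicographically (`leafCode_lt`). A step
inside a leaf which does not connect mates changes a label `v₊` of the near circle of its crossing
into `v₋`. The remaining condition at this crossing is thereby destroyed (if the 0-smoothing is the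
cutting one) or established (if the 1-smoothing is), and it is affected at no more than one other
crossing, namely one whose far circle is this near circle. That crossing is closer to the base end.
Hence there is a potential which decreases: every crossing at which the condition holds contributes
the size of its near side, with a sign given by the cutting smoothing (`pot_lt`).

In an unmatched enhanced state all crossings of the leaf are cut, with prescribed labels on their
far circles; there is one further circle, the one through the base end
(`HasState.rel_base_or_rel_far`).
So there are two unmatched enhanced states for every leaf, while every leaf has exactly one
one-circle state, in which no crossing is cut (`baseState`). Since the smoothing which respects the
orientation at a nugatory crossing is the cutting one (`IsReduced.out_eq_iff`), the degrees of the
unmatched enhanced states can be read off from the writhe of the leaf (`IsCritical.deg_eq`,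
`IsCritical.qdeg_eq`).

Two facts about planar diagrams are used. Changing a smoothing always merges two circles or splits
one (`State.isMerge_or_isMerge`): by Euler's formula and duality modulo 2 the faces have a
checkerboard colouring, which gives the edges an orientation respected by all smoothings
(`exists_isAlternating`), so that the circles are the cycles of a permutation which changes by a
transposition. And `d ∘ d = 0` (`d_comp_d`): identifying `𝒜` with `ℤ[x]/(x²)`, the merging map sets
two variables equal and the splitting map multiplies by the sum of two variables. Hence all maps are
determined by their effect on monomials in variables attached to the ends, on which any two of them
are seen to commute.
-/

/-! ### Cycles of a permutation composed with a transposition -/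

namespace Equiv.Perm

variable {α : Type*} [DecidableEq α] {a b : α}

theorem pow_swap_mul_apply (p : Perm α) (k : ℕ)
    (ha : ∀ j, 0 < j → j < k → (p ^ j) a ≠ a) (hb : ∀ j, 0 < j → j < k → (p ^ j) a ≠ b) :
    ∀ j, j < k → ((swap a b * p) ^ j) a = (p ^ j) a := by
  intro j
  induction j with
  | zero => intro _; rfl
  | succ j ih =>
    intro hj
    have h : p ((p ^ j) a) = (p ^ (j + 1)) a := by rw [pow_succ', mul_apply]
    rw [pow_succ', mul_apply, ih (by omega), mul_apply, h]
    exact swap_apply_of_ne_of_ne (ha _ (by omega) hj) (hb _ (by omega) hj)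

/-- Composition with the transposition of two points on the same cycle splits this cycle. -/
theorem not_sameCycle_swap_mul [Finite α] {p : Perm α} (hab : a ≠ b) (h : p.SameCycle a b) :
    ¬ (swap a b * p).SameCycle a b := by
  classical
  have hex : ∃ k, 0 < k ∧ (p ^ k) a = b := by
    obtain ⟨k, hk⟩ := h.exists_nat_pow_eq
    refine ⟨k, Nat.pos_of_ne_zero ?_, hk⟩
    rintro rfl
    exact hab hk
  set k := Nat.find hex with hk
  obtain ⟨hk0, hkb⟩ := Nat.find_spec hex
  have hb : ∀ j, 0 < j → j < k → (p ^ j) a ≠ b := fun j h0 hj hj' =>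
    Nat.find_min hex hj ⟨h0, hj'⟩
  have ha : ∀ j, 0 < j → j < k → (p ^ j) a ≠ a := by
    intro j h0 hj hj'
    refine hb (k - j) (by omega) (by omega) ?_
    rw [← hkb, ← hk]
    conv_rhs => rw [← Nat.sub_add_cancel hj.le, pow_add, mul_apply, hj']
  have hq := pow_swap_mul_apply p k ha hb
  have hqk : ((swap a b * p) ^ k) a = a := by
    obtain ⟨m, hm⟩ : ∃ m, k = m + 1 := ⟨k - 1, by omega⟩
    rw [hm, pow_succ', mul_apply, hq m (by omega), mul_apply, ← mul_apply p, ← pow_succ', ← hm,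
      hkb, swap_apply_right]
  intro hs
  obtain ⟨n, hn⟩ := hs.exists_nat_pow_eq
  have hmul : ∀ i, (((swap a b * p) ^ k) ^ i) a = a := by
    intro i
    induction i with
    | zero => rfl
    | succ i ih => rw [pow_succ, mul_apply, hqk, ih]
  rw [← Nat.mod_add_div n k, pow_add, pow_mul, mul_apply, hmul, hq _ (Nat.mod_lt _ hk0)] at hn
  rcases Nat.eq_zero_or_pos (n % k) with h0 | h0
  · rw [h0] at hn
    exact hab hn
  · exact hb _ h0 (Nat.mod_lt _ hk0) hn

/-- Composition with the transposition of two points on different cycles joins these cycles. -/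
theorem sameCycle_swap_mul [Finite α] {p : Perm α} (h : ¬ p.SameCycle a b) :
    (swap a b * p).SameCycle a b := by
  classical
  have hex : ∃ k, 0 < k ∧ (p ^ k) a = a :=
    ⟨orderOf p, orderOf_pos p, by rw [pow_orderOf_eq_one]; rfl⟩
  set k := Nat.find hex with hk
  obtain ⟨hk0, hka⟩ := Nat.find_spec hex
  have hq := pow_swap_mul_apply (b := b) p k
    (fun j h0 hj hj' => Nat.find_min hex hj ⟨h0, hj'⟩) (fun j _ _ hj' => h ⟨j, by simpa using hj'⟩)
  obtain ⟨m, hm⟩ : ∃ m, k = m + 1 := ⟨k - 1, by omega⟩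
  refine ⟨(k : ℕ), ?_⟩
  rw [zpow_natCast, hm, pow_succ', mul_apply, hq m (by omega), mul_apply, ← mul_apply p,
    ← pow_succ', ← hm, hka, swap_apply_left]

end Equiv.Perm

namespace LinkDiagram

variable {D : LinkDiagram}

/-! ### Connectedness of ends in a partially smoothed diagram -/

/-- Two ends lie on the same connected component of the diagram `σ`. -/
def PartialState.Rel (σ : D.PartialState) (e e' : D.Ends) : Prop :=
  Quot.mk σ.Adj e = Quot.mk σ.Adj e'

/-- Two ends lie on the same circle of the Kauffman state `S`. -/
def State.Rel (S : D.State) (e e' : D.Ends) : Prop := S.toPartial.Rel e e'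

theorem partner_partner (b : Bool) (k : Fin 4) : partner b (partner b k) = k := by
  revert b k; decide

namespace PartialState

variable {σ τ : D.PartialState} {e e' e'' : D.Ends}

theorem Rel.refl (σ : D.PartialState) (e : D.Ends) : σ.Rel e e := rfl

theorem Rel.symm (h : σ.Rel e e') : σ.Rel e' e := Eq.symm h

theorem Rel.trans (h : σ.Rel e e') (h' : σ.Rel e' e'') : σ.Rel e e'' := Eq.trans h h'

theorem Rel.edge (σ : D.PartialState) (e : D.Ends) : σ.Rel e (D.edge e) :=
  Quot.sound (Or.inl rfl)

theorem Rel.partner {c : Fin D.n} {b : Bool} (h : σ c = some b) (k : Fin 4) :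
    σ.Rel (c, k) (c, LinkDiagram.partner b k) :=
  Quot.sound (Or.inr ⟨rfl, fun b' hb' => by
    rw [show σ c = some b' from hb'] at h
    cases h; rfl⟩)

theorem Rel.cross {c : Fin D.n} (h : σ c = none) (k k' : Fin 4) : σ.Rel (c, k) (c, k') :=
  Quot.sound (Or.inr ⟨rfl, fun b hb => by
    rw [show σ c = some b from hb] at h
    cases h⟩)

theorem Rel.apply_eq {α : Sort*} (f : D.Ends → α) (he : ∀ e, f (D.edge e) = f e)
    (hs : ∀ c b, σ c = some b → ∀ k, f (c, LinkDiagram.partner b k) = f (c, k))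
    (hn : ∀ c, σ c = none → ∀ k k', f (c, k) = f (c, k')) (h : σ.Rel e e') : f e = f e' := by
  have hf : ∀ a a', σ.Adj a a' → f a = f a' := by
    rintro ⟨c, k⟩ ⟨c', k'⟩ (h | ⟨h1, h2⟩)
    · rw [h, he]
    · obtain rfl : c' = c := h1
      rcases hc : σ c' with _ | b
      · exact hn _ hc _ _
      · rw [show k' = LinkDiagram.partner b k from h2 b hc, hs _ _ hc]
  exact congrArg (Quot.lift f hf) h

/-- Smoothing further crossings does not connect anything. -/
theorem Rel.mono (hστ : ∀ c b, τ c = some b → σ c = some b) (h : σ.Rel e e') : τ.Rel e e' := by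
  refine h.apply_eq (Quot.mk τ.Adj) (fun e => (Rel.edge τ e).symm) ?_ ?_
  · intro c b hc k
    rcases hτ : τ c with _ | b'
    · exact Rel.cross hτ _ _
    · have := hστ c b' hτ
      rw [hc] at this
      cases this
      exact (Rel.partner hτ k).symm
  · intro c hc k k'
    rcases hτ : τ c with _ | b'
    · exact Rel.cross hτ _ _
    · rw [hστ c b' hτ] at hc
      cases hc

theorem HasState.rel {S : D.State} (hS : σ.HasState S) (h : S.Rel e e') : σ.Rel e e' :=
  Rel.mono (fun c b hb => by rw [State.toPartial, hS c b hb]) h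

end PartialState

namespace State

variable {S S' : D.State} {e e' e'' : D.Ends} {c : Fin D.n}

theorem circle_eq_iff : S.circle e = S.circle e' ↔ S.Rel e e' := by
  simp [State.circle, State.Rel, PartialState.Rel]

theorem Rel.refl (S : D.State) (e : D.Ends) : S.Rel e e := rfl

theorem Rel.symm (h : S.Rel e e') : S.Rel e' e := Eq.symm h

theorem Rel.trans (h : S.Rel e e') (h' : S.Rel e' e'') : S.Rel e e'' := Eq.trans h h'

theorem Rel.edge (S : D.State) (e : D.Ends) : S.Rel e (D.edge e) := PartialState.Rel.edge _ e

theorem Rel.partner (S : D.State) (c : Fin D.n) (k : Fin 4) :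
    S.Rel (c, k) (c, LinkDiagram.partner (S c) k) :=
  PartialState.Rel.partner rfl k

theorem Rel.apply_eq {α : Sort*} (f : D.Ends → α) (he : ∀ e, f (D.edge e) = f e)
    (hs : ∀ c k, f (c, LinkDiagram.partner (S c) k) = f (c, k)) (h : S.Rel e e') : f e = f e' :=
  PartialState.Rel.apply_eq f he (fun c b hb k => by
    obtain rfl : S c = b := by simpa [State.toPartial] using hb
    exact hs c k) (fun c hc => by simp [State.toPartial] at hc) h

/-- Every end at a crossing is on the circle through the end number 0 or 2. -/
theorem rel_zero_or_two (S : D.State) (c : Fin D.n) (k : Fin 4) :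
    S.Rel (c, k) (c, 0) ∨ S.Rel (c, k) (c, 2) := by
  have h := Rel.partner S c k
  generalize S c = b at h
  fin_cases k
  · exact Or.inl (Rel.refl _ _)
  · cases b
    · exact Or.inl h
    · exact Or.inr h
  · exact Or.inr (Rel.refl _ _)
  · cases b
    · exact Or.inr h
    · exact Or.inl h

theorem rel_of_rel_zero_two (h : S.Rel (c, 0) (c, 2)) (k k' : Fin 4) : S.Rel (c, k) (c, k') := by
  have h0 : ∀ k, S.Rel (c, k) (c, 0) := fun k =>
    (rel_zero_or_two S c k).elim id (fun h' => h'.trans h.symm)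
  exact (h0 k).trans (h0 k').symm

/-- The states `S` and `S'` differ only at the crossing `c`, where two different circles of `S`
are merged into one circle of `S'`. Which of the two smoothings `S` has at `c` is left open, so
that the splitting of a circle is described by the same relation. -/
structure IsMerge (S S' : D.State) (c : Fin D.n) : Prop where
  off : ∀ c', c' ≠ c → S' c' = S c'
  not_rel : ¬ S.Rel (c, 0) (c, 2)
  rel : S'.Rel (c, 0) (c, 2)

/-- The end `e` is on a circle through the crossing `c`. -/
def Through (S : D.State) (c : Fin D.n) (e : D.Ends) : Prop := S.Rel e (c, 0) ∨ S.Rel e (c, 2)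

theorem through_self (S : D.State) (c : Fin D.n) (k : Fin 4) : S.Through c (c, k) :=
  rel_zero_or_two S c k

theorem Through.of_rel (h : S.Through c e) (h' : S.Rel e' e) : S.Through c e' :=
  h.imp h'.trans h'.trans

theorem IsMerge.rel_of_rel (h : S.IsMerge S' c) (hr : S.Rel e e') : S'.Rel e e' := by
  refine hr.apply_eq (Quot.mk S'.toPartial.Adj) (fun e => (Rel.edge S' e).symm) ?_
  intro c' k
  by_cases hc : c' = c
  · subst hc
    exact rel_of_rel_zero_two h.rel _ _
  · rw [← h.off c' hc]
    exact (Rel.partner S' c' k).symm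

/-- The circles of the merged state are those of the original one, with the two circles through
the crossing identified. -/
theorem IsMerge.rel_iff (h : S.IsMerge S' c) :
    S'.Rel e e' ↔ S.Rel e e' ∨ (S.Through c e ∧ S.Through c e') := by
  classical
  constructor
  · intro hr
    have key : (S.Rel e e ∨ (S.Through c e ∧ S.Through c e)) =
        (S.Rel e e' ∨ (S.Through c e ∧ S.Through c e')) := by
      refine hr.apply_eq (fun a => (S.Rel e a ∨ (S.Through c e ∧ S.Through c a))) ?_ ?_
      · intro a
        have ha := Rel.edge S a
        exact propext (or_congr ⟨fun h => h.trans ha.symm, fun h => h.trans ha⟩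
          (and_congr_right fun _ => ⟨fun h => h.of_rel ha, fun h => h.of_rel ha.symm⟩))
      · intro c' k
        by_cases hc : c' = c
        · subst hc
          have : ∀ k, (S.Rel e (c', k) ∨ (S.Through c' e ∧ S.Through c' (c', k))) ↔
              S.Through c' e := fun k =>
            ⟨fun h => h.elim (fun h => (through_self S c' k).of_rel h) And.left,
              fun h => Or.inr ⟨h, through_self S c' k⟩⟩
          exact propext ((this _).trans (this _).symm)
        · have ha := Rel.partner S c' k
          rw [h.off c' hc]
          exact propext (or_congr ⟨fun h => h.trans ha.symm, fun h => h.trans ha⟩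
            (and_congr_right fun _ => ⟨fun h => h.of_rel ha, fun h => h.of_rel ha.symm⟩))
    exact key.mp (Or.inl rfl)
  · rintro (hr | ⟨h1, h2⟩)
    · exact h.rel_of_rel hr
    · have h0 : ∀ a, S.Through c a → S'.Rel a (c, 0) := fun a ha =>
        ha.elim h.rel_of_rel (fun h' => (h.rel_of_rel h').trans h.rel.symm)
      exact (h0 e h1).trans (h0 e' h2).symm

theorem IsMerge.rel_zero_iff (h : S.IsMerge S' c) : S'.Rel e (c, 0) ↔ S.Through c e := by
  rw [h.rel_iff]
  exact ⟨fun h => h.elim Or.inl And.left, fun h => Or.inr ⟨h, through_self S c 0⟩⟩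

theorem IsMerge.through_iff (h : S.IsMerge S' c) : S'.Through c e ↔ S.Through c e := by
  rw [← h.rel_zero_iff]
  exact ⟨fun h' => h'.elim id (fun h'' => h''.trans h.rel.symm), Or.inl⟩

end State

/-! ### Splitting and merging in a planar diagram -/

/-- An alternating orientation of the edges: at every crossing, the edges are directed alternately
away from and towards the crossing. Every smoothing respects such an orientation. -/
structure IsAlternating (out : D.Ends → Bool) : Prop where
  edge : ∀ e, out (D.edge e) = !out e
  next : ∀ c k, out (c, k + 1) = !out (c, k)

namespace IsAlternating

variable {out : D.Ends → Bool}

theorem neg (h : IsAlternating out) : IsAlternating (fun e => !out e) :=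
  ⟨fun e => by rw [h.edge], fun c k => by rw [h.next]⟩

theorem partner (h : IsAlternating out) (b : Bool) (c : Fin D.n) (k : Fin 4) :
    out (c, LinkDiagram.partner b k) = !out (c, k) := by
  have h0 := h.next c 0
  have h1 := h.next c 1
  have h2 := h.next c 2
  have h3 := h.next c 3
  cases b <;> fin_cases k <;> simp_all [LinkDiagram.partner]

theorem across (h : IsAlternating out) (S : D.State) (e : D.Ends) :
    out (S.toPartial.across e) = !out e :=
  h.partner (S e.1) e.1 e.2

/-- Following the circles of `S` in the direction given by an alternating orientation: the
permutation of the outgoing ends which goes along the edge and then along the smoothed crossing. -/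
def circlePerm (h : IsAlternating out) (S : D.State) : Equiv.Perm {e : D.Ends // out e = true} where
  toFun e := ⟨S.toPartial.across (D.edge e), by rw [h.across, h.edge, e.2]; rfl⟩
  invFun e := ⟨D.edge (S.toPartial.across e), by rw [h.edge, h.across, e.2]; rfl⟩
  left_inv e := Subtype.ext (by simp [PartialState.across_across, D.edge_edge])
  right_inv e := Subtype.ext (by simp [PartialState.across_across, D.edge_edge])

theorem rel_across (S : D.State) (e : D.Ends) : S.Rel e (S.toPartial.across e) :=
  State.Rel.partner S e.1 e.2

theorem sameCycle_circlePerm_iff (h : IsAlternating out) (S : D.State)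
    (a b : {e : D.Ends // out e = true}) :
    (h.circlePerm S).SameCycle a b ↔ S.Rel a b := by
  constructor
  · intro hs
    obtain ⟨n, rfl⟩ := hs.exists_nat_pow_eq
    induction n with
    | zero => exact State.Rel.refl _ _
    | succ n ih =>
      rw [pow_succ', Equiv.Perm.mul_apply]
      exact (ih ⟨n, rfl⟩).trans ((State.Rel.edge S _).trans (rel_across S _))
  · intro hr
    have hstep : ∀ x, (h.circlePerm S).SameCycle (h.circlePerm S x) x := fun x =>
      (Equiv.Perm.SameCycle.refl _ x).apply_left
    let f : D.Ends → {e : D.Ends // out e = true} := fun e =>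
      if he : out e = true then ⟨e, he⟩
      else ⟨D.edge e, by rw [h.edge]; simpa using he⟩
    have key : (h.circlePerm S).SameCycle (f a) = (h.circlePerm S).SameCycle (f b) := by
      have hsc : ∀ x y, (h.circlePerm S).SameCycle x y →
          (h.circlePerm S).SameCycle x = (h.circlePerm S).SameCycle y := fun x y hxy =>
        funext fun z => propext ⟨hxy.symm.trans, hxy.trans⟩
      refine hr.apply_eq (fun e => (h.circlePerm S).SameCycle (f e)) (fun e => ?_) (fun c k => ?_)
      · rcases he : out e with _ | _
        · have : f (D.edge e) = f e := by
            simp [f, he, h.edge]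
          rw [this]
        · have : f (D.edge e) = f e := by
            simp [f, he, h.edge, D.edge_edge]
          rw [this]
      · have hp := h.partner (S c) c k
        rcases he : out (c, k) with _ | _
        · have h1 : out (c, LinkDiagram.partner (S c) k) = true := by rw [hp, he]; rfl
          have : f (c, LinkDiagram.partner (S c) k) = h.circlePerm S (f (c, k)) := by
            apply Subtype.ext
            simp only [f, he, h1, circlePerm, dif_pos, Equiv.coe_fn_mk]
            simp [PartialState.across, State.toPartial, D.edge_edge]
          rw [this]
          exact hsc _ _ (hstep _)
        · have h1 : out (c, LinkDiagram.partner (S c) k) = false := by rw [hp, he]; rfl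
          have : h.circlePerm S (f (c, LinkDiagram.partner (S c) k)) = f (c, k) := by
            apply Subtype.ext
            simp only [f, he, h1, circlePerm, Equiv.coe_fn_mk]
            simp [PartialState.across, State.toPartial, D.edge_edge, partner_partner]
          rw [← this]
          exact hsc _ _ (hstep _).symm
    have ha : f a = a := by simp [f, a.2]
    have hb : f b = b := by simp [f, b.2]
    rw [ha, hb] at key
    rw [key]

/-- Two smoothings of a crossing traverse the outgoing ends in orders which differ by the
transposition of the two outgoing ends at this crossing. -/
theorem circlePerm_update (h : IsAlternating out) (S : D.State) (c : Fin D.n)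
    (h0 : out (c, 0) = true) (h2 : out (c, 2) = true) :
    h.circlePerm (Function.update S c true) =
      Equiv.swap ⟨(c, 0), h0⟩ ⟨(c, 2), h2⟩ * h.circlePerm (Function.update S c false) := by
  have h1 : out (c, 1) = false := by have := h.next c 0; rw [h0] at this; exact this
  have h3 : out (c, 3) = false := by have := h.next c 2; rw [h2] at this; exact this
  ext1 ⟨e, he⟩
  apply Subtype.ext
  rw [Equiv.Perm.mul_apply, Equiv.swap_apply_def]
  have hout : out (D.edge e) = false := by rw [h.edge, he]; rfl
  simp only [circlePerm, Equiv.coe_fn_mk, Subtype.mk.injEq, apply_ite Subtype.val]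
  generalize hx : D.edge e = x at hout
  obtain ⟨c', k⟩ := x
  by_cases hc : c' = c
  · subst hc
    fin_cases k <;> simp_all [PartialState.across, State.toPartial, LinkDiagram.partner]
  · simp [PartialState.across, State.toPartial, hc]

/-- In a diagram with an alternating orientation, exactly one of the two smoothings of a crossing
puts the two sides of the crossing on the same circle. -/
theorem rel_update_iff (h : IsAlternating out) (S : D.State) (c : Fin D.n) :
    State.Rel (Function.update S c true) (c, 0) (c, 2) ↔
      ¬ State.Rel (Function.update S c false) (c, 0) (c, 2) := by
  wlog h0 : out (c, 0) = true generalizing out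
  · exact this h.neg (by simpa using h0)
  have h2 : out (c, 2) = true := by
    have h01 := h.next c 0
    have h12 := h.next c 1
    simp_all
  have hab : (⟨(c, 0), h0⟩ : {e : D.Ends // out e = true}) ≠ ⟨(c, 2), h2⟩ := by simp
  have e1 := h.sameCycle_circlePerm_iff (Function.update S c true) ⟨(c, 0), h0⟩ ⟨(c, 2), h2⟩
  have e2 := h.sameCycle_circlePerm_iff (Function.update S c false) ⟨(c, 0), h0⟩ ⟨(c, 2), h2⟩
  rw [← e1, ← e2, h.circlePerm_update S c h0 h2]
  exact ⟨fun h1 h2 => Equiv.Perm.not_sameCycle_swap_mul hab h2 h1, Equiv.Perm.sameCycle_swap_mul⟩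

end IsAlternating

/-! ### The checkerboard colouring -/

section Checkerboard

open Module
open scoped Matrix

variable (D)

/-- The faces of the projection, each given by the ends next to which it lies. -/
abbrev Faces : Type := Quot fun e e' : D.Ends => e' = ((D.edge e).1, (D.edge e).2 + 1)

/-- The connected components of the graph underlying the projection. -/
abbrev GraphComponents : Type := Quot fun e e' : D.Ends => e' = D.edge e ∨ e'.1 = e.1

/-- The coboundary of a set of faces: the edges which have this set on exactly one side. -/
def faceCoboundary : (D.Faces → ZMod 2) →ₗ[ZMod 2] (D.Ends → ZMod 2) where
  toFun g e := g (Quot.mk _ e) + g (Quot.mk _ (D.edge e))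
  map_add' g g' := by ext e; simp only [Pi.add_apply]; ring
  map_smul' a g := by ext e; simp only [Pi.smul_apply, smul_eq_mul, RingHom.id_apply]; ring

/-- The sum of the values at the two ends of an edge. -/
def edgeSum : (D.Ends → ZMod 2) →ₗ[ZMod 2] (D.Ends → ZMod 2) where
  toFun f e := f e + f (D.edge e)
  map_add' g g' := by ext e; simp only [Pi.add_apply]; ring
  map_smul' a g := by ext e; simp only [Pi.smul_apply, smul_eq_mul, RingHom.id_apply]; ring

/-- Functions of the crossing, regarded as functions of the end. -/
def crossingPullback : (Fin D.n → ZMod 2) →ₗ[ZMod 2] (D.Ends → ZMod 2) :=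
  LinearMap.funLeft (ZMod 2) (ZMod 2) Prod.fst

/-- The functionals on functions of the ends, given by their coefficients, which vanish on the
coboundaries of the sets of faces. -/
def annihilator : Submodule (ZMod 2) (D.Ends → ZMod 2) where
  carrier := {l | ∀ g, ∑ e, l e * D.faceCoboundary g e = 0}
  add_mem' := by
    intro a b ha hb g
    simp only [Pi.add_apply, add_mul, Finset.sum_add_distrib, ha g, hb g, add_zero]
  zero_mem' := by intro g; simp
  smul_mem' := by
    intro r a ha g
    simp only [Pi.smul_apply, smul_eq_mul, mul_assoc, ← Finset.mul_sum, ha g, mul_zero]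

variable {D}

theorem add_self_zmod_two (x : ZMod 2) : x + x = 0 := by
  revert x; decide

theorem eq_of_add_eq_zero_zmod_two {x y : ZMod 2} (h : x + y = 0) : x = y := by
  revert x y; decide

theorem sum_eq_zero_of_mem_ker_edgeSum {l : D.Ends → ZMod 2} (hl : l ∈ LinearMap.ker D.edgeSum) :
    ∑ e, l e = 0 := by
  have h : ∀ e, l e + l (D.edge e) = 0 := fun e => congrFun hl e
  exact Finset.sum_involution (fun e _ => D.edge e) (fun e _ => h e)
    (fun e _ _ => D.edge_ne e) (fun e _ => Finset.mem_univ _) (fun e _ => D.edge_edge e)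

theorem ker_edgeSum_le_annihilator : LinearMap.ker D.edgeSum ≤ D.annihilator := by
  intro l hl g
  refine sum_eq_zero_of_mem_ker_edgeSum ?_
  ext e
  have h : l (D.edge e) = l e := (eq_of_add_eq_zero_zmod_two (congrFun hl e)).symm
  change l e * (_ + _) + l (D.edge e) * (_ + _) = 0
  rw [h, D.edge_edge, add_comm (g _), add_self_zmod_two]

theorem range_crossingPullback_le_annihilator :
    LinearMap.range D.crossingPullback ≤ D.annihilator := by
  rintro _ ⟨l, rfl⟩ g
  have h1 : ∀ c k, g (Quot.mk _ (D.edge (c, k))) = g (Quot.mk _ (c, k + 1)) := by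
    intro c k
    congr 1
    refine Quot.sound ?_
    simp [D.edge_edge]
  rw [Fintype.sum_prod_type]
  refine Finset.sum_eq_zero fun c _ => ?_
  change ∑ k, l c * (g (Quot.mk _ (c, k)) + g (Quot.mk _ (D.edge (c, k)))) = 0
  have h2 : ∑ k : Fin 4, g (Quot.mk _ (c, k + 1)) = ∑ k : Fin 4, g (Quot.mk _ (c, k)) :=
    Equiv.sum_comp (Equiv.addRight (1 : Fin 4)) (fun k => g (Quot.mk _ (c, k)))
  simp only [h1, ← Finset.mul_sum, Finset.sum_add_distrib]
  rw [h2, add_self_zmod_two, mul_zero]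

theorem card_edges_le_finrank_ker_edgeSum :
    2 * D.n ≤ finrank (ZMod 2) (LinearMap.ker D.edgeSum) := by
  have h1 : LinearMap.range D.edgeSum ≤ LinearMap.ker D.edgeSum := by
    rintro _ ⟨f, rfl⟩
    ext e
    change f e + f (D.edge e) + (f (D.edge e) + f (D.edge (D.edge e))) = 0
    rw [D.edge_edge, add_comm (f (D.edge e)) (f e), add_self_zmod_two]
  have h2 := LinearMap.finrank_range_add_finrank_ker D.edgeSum
  have h3 := Submodule.finrank_mono h1
  simp only [finrank_fintype_fun_eq_card, Fintype.card_prod, Fintype.card_fin] at h2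
  omega

theorem finrank_le_card_graphComponents {V : Submodule (ZMod 2) (D.Ends → ZMod 2)}
    (h1 : ∀ f ∈ V, ∀ e, f (D.edge e) = f e) (h2 : ∀ f ∈ V, ∀ c k k', f (c, k) = f (c, k')) :
    finrank (ZMod 2) V ≤ Nat.card D.GraphComponents := by
  classical
  have : Fintype D.GraphComponents := Fintype.ofFinite _
  rw [Nat.card_eq_fintype_card, ← finrank_fintype_fun_eq_card (ZMod 2) (η := D.GraphComponents)]
  have hV : V ≤ LinearMap.range (LinearMap.funLeft (ZMod 2) (ZMod 2)
      (Quot.mk _ : D.Ends → D.GraphComponents)) := by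
    intro f hf
    refine ⟨Quot.lift f ?_, rfl⟩
    rintro ⟨c, k⟩ ⟨c', k'⟩ (h | h)
    · rw [h, h1 f hf]
    · obtain rfl : c' = c := h
      exact h2 f hf _ _ _
  exact (Submodule.finrank_mono hV).trans (LinearMap.finrank_range_le _)

theorem finrank_ker_faceCoboundary_le :
    finrank (ZMod 2) (LinearMap.ker D.faceCoboundary) ≤ Nat.card D.GraphComponents := by
  let q : (D.Faces → ZMod 2) →ₗ[ZMod 2] (D.Ends → ZMod 2) :=
    LinearMap.funLeft (ZMod 2) (ZMod 2) (Quot.mk _)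
  have hq : Function.Injective q :=
    LinearMap.funLeft_injective_of_surjective _ _ _ Quot.mk_surjective
  rw [LinearEquiv.finrank_eq (Submodule.equivMapOfInjective q hq _)]
  have hedge : ∀ g ∈ LinearMap.ker D.faceCoboundary, ∀ e, q g (D.edge e) = q g e := fun g hg e =>
    (eq_of_add_eq_zero_zmod_two (congrFun hg e)).symm
  refine finrank_le_card_graphComponents ?_ ?_
  · rintro _ ⟨g, hg, rfl⟩ e
    exact hedge g hg e
  · rintro _ ⟨g, hg, rfl⟩ c k k'
    have hs : ∀ k, q g (c, k + 1) = q g (c, k) := fun k => by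
      rw [← hedge g hg (c, k)]
      refine congrArg g (Quot.sound ?_).symm
      simp [D.edge_edge]
    have h1 := hs 0
    have h2 := hs 1
    have h3 := hs 2
    fin_cases k <;> fin_cases k' <;> simp_all

theorem three_mul_le_finrank_sup :
    3 * D.n ≤ finrank (ZMod 2)
      (LinearMap.ker D.edgeSum ⊔ LinearMap.range D.crossingPullback : Submodule _ _) +
      Nat.card D.GraphComponents := by
  have h1 := Submodule.finrank_sup_add_finrank_inf_eq (LinearMap.ker D.edgeSum)
    (LinearMap.range D.crossingPullback)
  have h2 := D.card_edges_le_finrank_ker_edgeSum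
  have h3 : finrank (ZMod 2) (LinearMap.range D.crossingPullback) = D.n := by
    have hinj : Function.Injective D.crossingPullback :=
      LinearMap.funLeft_injective_of_surjective _ _ _ Prod.fst_surjective
    rw [LinearMap.finrank_range_of_inj hinj]
    simp
  have h4 : finrank (ZMod 2)
      (LinearMap.ker D.edgeSum ⊓ LinearMap.range D.crossingPullback : Submodule _ _) ≤
      Nat.card D.GraphComponents := by
    refine finrank_le_card_graphComponents ?_ ?_
    · rintro f ⟨hf, -⟩ e
      exact (eq_of_add_eq_zero_zmod_two (congrFun hf e)).symm
    · rintro _ ⟨-, l, rfl⟩ c k k'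
      rfl
  omega

/-- The coefficient functionals vanishing on all coboundaries have the dimension complementary to
that of the space of coboundaries. -/
theorem finrank_annihilator :
    finrank (ZMod 2) D.annihilator + finrank (ZMod 2) (LinearMap.range D.faceCoboundary) =
      4 * D.n := by
  classical
  have : Fintype D.Faces := Fintype.ofFinite _
  set M := LinearMap.toMatrix' D.faceCoboundary with hM
  have h1 : D.annihilator = LinearMap.ker (Mᵀ).mulVecLin := by
    ext l
    rw [LinearMap.mem_ker, Matrix.mulVecLin_apply]
    have hdot : ∀ g, ∑ e, l e * D.faceCoboundary g e = (Mᵀ.mulVec l) ⬝ᵥ g := by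
      intro g
      rw [← LinearMap.toMatrix'_mulVec D.faceCoboundary g, ← hM, Matrix.mulVec_transpose,
        ← Matrix.dotProduct_mulVec]
      rfl
    constructor
    · intro hl
      exact dotProduct_eq_zero _ fun g => by rw [← hdot, hl g]
    · intro hl g
      rw [hdot, hl, zero_dotProduct]
  have h2 := LinearMap.finrank_range_add_finrank_ker (Mᵀ).mulVecLin
  have h3 : finrank (ZMod 2) (LinearMap.range (Mᵀ).mulVecLin) =
      finrank (ZMod 2) (LinearMap.range D.faceCoboundary) := by
    change Mᵀ.rank = _
    rw [Matrix.rank_transpose, Matrix.rank, hM]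
    exact congrArg (fun f => finrank (ZMod 2) (LinearMap.range f))
      (Matrix.toLin'_toMatrix' D.faceCoboundary)
  simp only [finrank_fintype_fun_eq_card, Fintype.card_prod, Fintype.card_fin] at h2
  rw [h1]
  omega

variable (D) in
/-- The projection of a planar diagram has a checkerboard colouring, hence an alternating
orientation: by Euler's formula, every functional vanishing on the coboundaries of sets of faces
is a sum of one which is invariant under `edge` and one which depends on the crossing only. Such
functionals vanish on the set of all edges, which is therefore a coboundary. -/
theorem exists_isAlternating : ∃ out : D.Ends → Bool, IsAlternating out := by
  classical
  have hsup : LinearMap.ker D.edgeSum ⊔ LinearMap.range D.crossingPullback = D.annihilator := by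
    refine Submodule.eq_of_le_of_finrank_le
      (sup_le ker_edgeSum_le_annihilator range_crossingPullback_le_annihilator) ?_
    have : Fintype D.Faces := Fintype.ofFinite _
    have h1 := D.finrank_annihilator
    have h2 := D.three_mul_le_finrank_sup
    have h3 := D.finrank_ker_faceCoboundary_le
    have h4 := LinearMap.finrank_range_add_finrank_ker D.faceCoboundary
    rw [finrank_fintype_fun_eq_card, ← Nat.card_eq_fintype_card] at h4
    have h5 : Nat.card D.Faces = D.n + 2 * Nat.card D.GraphComponents := D.planar
    omega
  have hone : (fun _ => 1 : D.Ends → ZMod 2) ∈ LinearMap.range D.faceCoboundary := by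
    by_contra hne
    obtain ⟨f, hf, hle⟩ := Submodule.exists_le_ker_of_notMem hne
    have hfe : ∀ h, f h = ∑ e, f (Pi.single e 1) * h e := by
      intro h
      conv_lhs => rw [pi_eq_sum_univ' h]
      simp only [map_sum, map_smul, smul_eq_mul]
      exact Finset.sum_congr rfl fun e _ => by rw [mul_comm]
    have hmem : (fun e => f (Pi.single e 1)) ∈ D.annihilator := by
      intro g
      rw [← hfe]
      exact hle ⟨g, rfl⟩
    rw [← hsup, Submodule.mem_sup] at hmem
    obtain ⟨l, hl, _, ⟨m, rfl⟩, hlm⟩ := hmem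
    apply hf
    rw [hfe]
    simp only [mul_one]
    change ∑ e, (fun e => f (Pi.single e 1)) e = 0
    rw [← hlm]
    simp only [Pi.add_apply, Finset.sum_add_distrib, sum_eq_zero_of_mem_ker_edgeSum hl, zero_add]
    rw [Fintype.sum_prod_type]
    refine Finset.sum_eq_zero fun c _ => ?_
    change ∑ k : Fin 4, m c = 0
    simp only [Finset.sum_const, Finset.card_univ, Fintype.card_fin, nsmul_eq_mul]
    have : ((4 : ℕ) : ZMod 2) = 0 := by decide
    rw [this, zero_mul]
  obtain ⟨g, hg⟩ := hone
  have hedge : ∀ e, g (Quot.mk _ (D.edge e)) = g (Quot.mk _ e) + 1 := by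
    intro e
    have h : g (Quot.mk _ e) + g (Quot.mk _ (D.edge e)) = 1 := congrFun hg e
    revert h
    generalize g (Quot.mk _ e) = x
    generalize g (Quot.mk _ (D.edge e)) = y
    revert x y
    decide
  have hbool : ∀ x : ZMod 2, decide (x + 1 = 1) = !decide (x = 1) := by decide
  refine ⟨fun e => decide (g (Quot.mk _ e) = 1), fun e => ?_, fun c k => ?_⟩
  · simp only [hedge, hbool]
  · have h : g (Quot.mk _ (c, k + 1)) = g (Quot.mk _ (c, k)) + 1 := by
      rw [← hedge]
      refine congrArg g (Quot.sound ?_).symm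
      simp [D.edge_edge]
    simp only [h, hbool]

end Checkerboard

/-- Changing one smoothing of a planar diagram either merges two circles or splits one. -/
theorem State.isMerge_or_isMerge (S S' : D.State) (c : Fin D.n) (b : Bool) (hc : S c = b)
    (hS : S' = Function.update S c !b) : S.IsMerge S' c ∨ S'.IsMerge S c := by
  obtain ⟨out, h⟩ := D.exists_isAlternating
  have hoff : ∀ c', c' ≠ c → S' c' = S c' := fun c' hc' => by
    rw [hS, Function.update_of_ne hc']
  have hoff' : ∀ c', c' ≠ c → S c' = S' c' := fun c' hc' => (hoff c' hc').symm
  have h1 := h.rel_update_iff S c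
  have hSb : Function.update S c b = S := by rw [← hc, Function.update_eq_self]
  have key : State.Rel S' (c, 0) (c, 2) ↔ ¬ State.Rel S (c, 0) (c, 2) := by
    cases b
    · rwa [hSb, ← show S' = Function.update S c true from hS] at h1
    · rw [hSb, ← show S' = Function.update S c false from hS] at h1
      rw [h1, not_not]
  by_cases hr : S.Rel (c, 0) (c, 2)
  · exact Or.inr ⟨hoff', fun h' => key.mp h' hr, hr⟩
  · exact Or.inl ⟨hoff, hr, key.mpr hr⟩

/-! ### Sums over circles and the grading -/

theorem State.circle_surjective [IsEmpty (Fin D.loops)] (S : D.State) :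
    Function.Surjective S.circle := by
  rintro (e | l)
  · obtain ⟨e, rfl⟩ := Quot.exists_rep e
    exact ⟨e, rfl⟩
  · exact isEmptyElim l

/-- Compares the sums of two functions of the circles before and after a merger, if the functions
agree on the circles which are not merged. -/
theorem State.IsMerge.sum_circles [IsEmpty (Fin D.loops)] {S S' : D.State} {c : Fin D.n}
    (h : S.IsMerge S' c) (g : S.Circles → ℤ) (g' : S'.Circles → ℤ)
    (hg : ∀ e, ¬ S.Through c e → g' (S'.circle e) = g (S.circle e)) :
    ∑ C, g C + g' (S'.circle (c, 0)) =
      ∑ C, g' C + (g (S.circle (c, 0)) + g (S.circle (c, 2))) := by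
  classical
  let F : S.Circles → S'.Circles :=
    Sum.elim (Quot.lift S'.circle fun e e' he =>
      circle_eq_iff.mpr (h.rel_of_rel (Quot.sound he))) isEmptyElim
  have hF : ∀ e, F (S.circle e) = S'.circle e := fun e => rfl
  have hne : S.circle (c, 2) ∈ Finset.univ.erase (S.circle (c, 0)) := by
    simp only [Finset.mem_erase, Finset.mem_univ, and_true]
    exact fun h' => h.not_rel (circle_eq_iff.mp h').symm
  have hmem : ∀ e, S.circle e ∈ (Finset.univ.erase (S.circle (c, 0))).erase (S.circle (c, 2)) ↔
      ¬ S.Through c e := by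
    intro e
    simp only [Finset.mem_erase, Finset.mem_univ, and_true, ne_eq, circle_eq_iff, Through, not_or]
    exact and_comm
  have hmem' : ∀ e, S'.circle e ∈ Finset.univ.erase (S'.circle (c, 0)) ↔ ¬ S.Through c e := by
    intro e
    simp only [Finset.mem_erase, Finset.mem_univ, and_true, ne_eq, circle_eq_iff, h.rel_zero_iff]
  have key : ∑ C ∈ (Finset.univ.erase (S.circle (c, 0))).erase (S.circle (c, 2)), g C =
      ∑ C ∈ Finset.univ.erase (S'.circle (c, 0)), g' C := by
    refine Finset.sum_bij (fun C _ => F C) ?_ ?_ ?_ ?_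
    · intro C hC
      obtain ⟨e, rfl⟩ := S.circle_surjective C
      rw [hF, hmem', ← hmem]
      exact hC
    · intro C hC C' hC' hCC
      obtain ⟨e, rfl⟩ := S.circle_surjective C
      obtain ⟨e', rfl⟩ := S.circle_surjective C'
      rw [hF, hF, circle_eq_iff, h.rel_iff] at hCC
      rw [hmem] at hC
      exact circle_eq_iff.mpr (hCC.resolve_right fun h' => hC h'.1)
    · intro C hC
      obtain ⟨e, rfl⟩ := S'.circle_surjective C
      exact ⟨S.circle e, (hmem e).mpr ((hmem' e).mp hC), rfl⟩
    · intro C hC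
      obtain ⟨e, rfl⟩ := S.circle_surjective C
      exact (hg e ((hmem e).mp hC)).symm
  rw [← Finset.add_sum_erase _ g (Finset.mem_univ (S.circle (c, 0))),
    ← Finset.add_sum_erase _ g hne, key,
    ← Finset.add_sum_erase _ g' (Finset.mem_univ (S'.circle (c, 0)))]
  ring

theorem State.IsMerge.card_circles [IsEmpty (Fin D.loops)] {S S' : D.State} {c : Fin D.n}
    (h : S.IsMerge S' c) :
    Fintype.card S.Circles = Fintype.card S'.Circles + 1 := by
  have := h.sum_circles (fun _ => 1) (fun _ => 1) (fun _ _ => rfl)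
  simp only [Finset.sum_const, Finset.card_univ, nsmul_eq_mul, mul_one] at this
  omega

namespace EnhancedState

variable {X Y : D.EnhancedState} {c c' : Fin D.n} {e e' : D.Ends}

theorem labelAt_congr (h : X.state.Rel e e') : X.labelAt e = X.labelAt e' := by
  rw [labelAt, labelAt, State.circle_eq_iff.mpr h]

theorem ext_labelAt [IsEmpty (Fin D.loops)] (hs : X.state = Y.state)
    (hl : ∀ e, X.labelAt e = Y.labelAt e) : X = Y := by
  obtain ⟨S, l⟩ := X
  obtain ⟨S', l'⟩ := Y
  obtain rfl : S = S' := hs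
  congr 1
  funext C
  obtain ⟨e, rfl⟩ := S.circle_surjective C
  exact hl e

/-- The enhanced state with given labels of the ends. -/
def ofEnds [IsEmpty (Fin D.loops)] (S : D.State) (l : D.Ends → Bool)
    (h : ∀ e e', S.Rel e e' → l e = l e') : D.EnhancedState where
  state := S
  label := Sum.elim (Quot.lift l fun e e' he => h e e' (Quot.sound he)) isEmptyElim

theorem labelAt_ofEnds [IsEmpty (Fin D.loops)] (S : D.State) (l : D.Ends → Bool)
    (h : ∀ e e', S.Rel e e' → l e = l e') (e : D.Ends) : (ofEnds S l h).labelAt e = l e := rfl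

theorem isStep_iff [IsEmpty (Fin D.loops)] :
    IsStep X Y c ↔ X.state c = false ∧ Y.state = Function.update X.state c true ∧
      ∀ e, ¬ X.state.Through c e → Y.labelAt e = X.labelAt e := by
  simp only [IsStep, State.Through, not_or, ne_eq, State.circle_eq_iff, IsEmpty.forall_iff,
    and_true, and_imp]

theorem IsStep.isMerge_or_isMerge (h : IsStep X Y c) :
    X.state.IsMerge Y.state c ∨ Y.state.IsMerge X.state c :=
  State.isMerge_or_isMerge X.state Y.state c false h.1 h.2.1

theorem localCoeff_of_isMerge (h : X.state.IsMerge Y.state c) :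
    localCoeff X Y c = mulCoeff (X.labelAt (c, 0)) (X.labelAt (c, 2)) (Y.labelAt (c, 0)) := by
  rw [localCoeff, if_pos]
  exact ⟨fun h' => h.not_rel (State.circle_eq_iff.mp h'), State.circle_eq_iff.mpr h.rel⟩

theorem localCoeff_of_isMerge' (h : Y.state.IsMerge X.state c) :
    localCoeff X Y c = comulCoeff (X.labelAt (c, 0)) (Y.labelAt (c, 0)) (Y.labelAt (c, 2)) := by
  rw [localCoeff, if_neg, if_pos]
  · exact ⟨State.circle_eq_iff.mpr h.rel, fun h' => h.not_rel (State.circle_eq_iff.mp h')⟩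
  · exact fun h' => h'.1 (State.circle_eq_iff.mpr h.rel)

theorem IsStep.crossing_unique (h : IsStep X Y c) (h' : IsStep X Y c') : c = c' := by
  by_contra hne
  have h1 := congrFun h.2.1 c'
  rw [h'.2.1] at h1
  rw [Function.update_self, Function.update_of_ne (Ne.symm hne), h'.1] at h1
  cases h1

theorem IsStep.coeff_eq (h : IsStep X Y c) :
    coeff X Y = (-1) ^ (Finset.univ.filter fun c' : Fin D.n => c' < c ∧ X.state c' = true).card *
      localCoeff X Y c := by
  rw [coeff, Finset.sum_eq_single c]
  · rw [if_pos h]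
  · intro c' _ hne
    rw [if_neg fun h' => hne (h'.crossing_unique h)]
  · simp

theorem IsStep.coeff_ne_zero_iff (h : IsStep X Y c) : coeff X Y ≠ 0 ↔ localCoeff X Y c ≠ 0 := by
  rw [h.coeff_eq]
  simp

theorem exists_isStep_of_coeff_ne_zero (h : coeff X Y ≠ 0) :
    ∃ c, IsStep X Y c ∧ localCoeff X Y c ≠ 0 := by
  obtain ⟨c, -, hc⟩ := Finset.exists_ne_zero_of_sum_ne_zero h
  have hs : IsStep X Y c := by
    by_contra hs
    rw [if_neg hs] at hc
    exact hc rfl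
  exact ⟨c, hs, hs.coeff_ne_zero_iff.mp h⟩

theorem IsStep.r_eq (h : IsStep X Y c) : Y.state.r = X.state.r + 1 := by
  have : (Finset.univ.filter fun a => Y.state a = true) =
      insert c (Finset.univ.filter fun a => X.state a = true) := by
    ext a
    by_cases ha : a = c
    · subst ha; simp [h.2.1]
    · simp [h.2.1, ha]
  rw [State.r, State.r, this, Finset.card_insert_of_notMem (by simp [h.1])]

theorem deg_of_coeff_ne_zero (h : coeff X Y ≠ 0) : Y.deg = X.deg + 1 := by
  obtain ⟨c, hs, -⟩ := exists_isStep_of_coeff_ne_zero h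
  rw [deg, deg, hs.r_eq]
  push_cast
  ring

/-- The degree of a generator of `𝒜`. -/
def labelDegree (b : Bool) : ℤ := if b then 1 else -1

theorem qdeg_eq (X : D.EnhancedState) :
    X.qdeg = ∑ C, labelDegree (X.label C) + X.state.r := rfl

/-- The differential preserves the secondary degree. -/
theorem qdeg_of_coeff_ne_zero [IsEmpty (Fin D.loops)] (h : coeff X Y ≠ 0) : Y.qdeg = X.qdeg := by
  obtain ⟨c, hs, hl⟩ := exists_isStep_of_coeff_ne_zero h
  have hr := hs.r_eq
  have hlab := (isStep_iff.mp hs).2.2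
  have hmul : ∀ a b y, mulCoeff a b y ≠ 0 → labelDegree a + labelDegree b = labelDegree y + 1 := by
    decide
  have hcomul : ∀ a b y, comulCoeff a b y ≠ 0 →
      labelDegree b + labelDegree y = labelDegree a - 1 := by
    decide
  rw [qdeg_eq, qdeg_eq, hr]
  push_cast
  rcases hs.isMerge_or_isMerge with hm | hm
  · have h1 := hm.sum_circles (fun C => labelDegree (X.label C))
      (fun C => labelDegree (Y.label C)) (fun e he => by
        have := hlab e he
        rw [labelAt, labelAt] at this
        simp only [this])
    rw [localCoeff_of_isMerge hm] at hl
    have h2 := hmul _ _ _ hl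
    simp only [labelAt] at h2
    rw [h2] at h1
    linarith
  · have h1 := hm.sum_circles (fun C => labelDegree (Y.label C))
      (fun C => labelDegree (X.label C)) (fun e he => by
        have := hlab e (fun h' => he (hm.through_iff.mp h'))
        rw [labelAt, labelAt] at this
        simp only [this])
    rw [localCoeff_of_isMerge' hm] at hl
    have h2 := hcomul _ _ _ hl
    simp only [labelAt] at h2
    rw [h2] at h1
    linarith

end EnhancedState

/-! ### The differential squares to zero -/

noncomputable instance : DecidableEq D.EnhancedState := Classical.decEq _

open Classical in
/-- The exponent in which the variable of the circle through `e` occurs in the monomial in the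
ends with exponents `m`, when all ends on a circle of `S` are given the same variable. -/
noncomputable def State.mult (S : D.State) (m : D.Ends → ℕ) (e : D.Ends) : ℕ :=
  ∑ e', if S.Rel e' e then m e' else 0

namespace State

variable {S S' : D.State} {m : D.Ends → ℕ} {e e' : D.Ends} {c : Fin D.n}

theorem mult_congr (h : S.Rel e e') : S.mult m e = S.mult m e' := by
  classical
  refine Finset.sum_congr rfl fun a _ => ?_
  rw [show S.Rel a e ↔ S.Rel a e' from ⟨fun h' => h'.trans h, fun h' => h'.trans h.symm⟩]

theorem mult_add_single_of_rel (h : S.Rel e' e) :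
    S.mult (m + Pi.single e' 1) e = S.mult m e + 1 := by
  classical
  rw [mult, mult]
  have : ∀ a, (if S.Rel a e then (m + Pi.single e' 1 : D.Ends → ℕ) a else 0) =
      (if S.Rel a e then m a else 0) + if a = e' then 1 else 0 := by
    intro a
    by_cases ha : a = e'
    · subst ha; simp [h]
    · by_cases hr : S.Rel a e <;> simp [ha, hr]
  rw [Finset.sum_congr rfl fun a _ => this a, Finset.sum_add_distrib]
  simp

theorem mult_add_single_of_not_rel (h : ¬ S.Rel e' e) :
    S.mult (m + Pi.single e' 1) e = S.mult m e := by
  classical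
  refine Finset.sum_congr rfl fun a _ => ?_
  by_cases ha : a = e'
  · subst ha; simp [h]
  · simp [ha]

theorem IsMerge.mult_of_not_through (h : S.IsMerge S' c) (he : ¬ S.Through c e) :
    S'.mult m e = S.mult m e := by
  classical
  refine Finset.sum_congr rfl fun a _ => ?_
  have : S'.Rel a e ↔ S.Rel a e := by
    rw [h.rel_iff]
    exact ⟨fun h' => h'.resolve_right fun h'' => he h''.2, Or.inl⟩
  rw [this]

theorem IsMerge.mult_self (h : S.IsMerge S' c) (k : Fin 4) :
    S'.mult m (c, k) = S.mult m (c, 0) + S.mult m (c, 2) := by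
  classical
  rw [mult_congr (rel_of_rel_zero_two h.rel k 0), mult, mult, mult, ← Finset.sum_add_distrib]
  refine Finset.sum_congr rfl fun a _ => ?_
  rw [h.rel_zero_iff, Through]
  by_cases h0 : S.Rel a (c, 0)
  · have h2 : ¬ S.Rel a (c, 2) := fun h2 => h.not_rel (h0.symm.trans h2)
    simp [h0, h2]
  · simp [h0]

end State

open Classical in
/-- The element of the summand of `S` given by a monomial in the ends: the circles of `S` are
labelled by `v₋` or `v₊`, according to whether their variable occurs or not. It is zero if the
variable of a circle occurs more than once. -/
noncomputable def monomial (S : D.State) (m : D.Ends → ℕ) : D.Chain := fun X =>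
  if X.state = S ∧ ∀ e, S.mult m e = if X.labelAt e then 0 else 1 then 1 else 0

open Classical in
/-- The part of the differential, without its sign, which changes the smoothing at `c`. -/
noncomputable def localD (c : Fin D.n) : D.Chain →ₗ[ℤ] D.Chain :=
  Matrix.mulVecLin (Matrix.of fun Y X =>
    if EnhancedState.IsStep X Y c then EnhancedState.localCoeff X Y c else 0)

/-- The sign with which the change of the smoothing at `c` enters the differential. -/
noncomputable def State.sign (S : D.State) (c : Fin D.n) : ℤ :=
  (-1) ^ (Finset.univ.filter fun c' : Fin D.n => c' < c ∧ S c' = true).card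

section Monomial

variable {S S' : D.State} {m : D.Ends → ℕ} {e e' : D.Ends} {c c' : Fin D.n}

theorem monomial_eq_zero (h : 2 ≤ S.mult m e) : monomial S m = 0 := by
  funext X
  refine if_neg fun hX => ?_
  have := hX.2 e
  split_ifs at this <;> omega

theorem monomial_eq_single [IsEmpty (Fin D.loops)] (X : D.EnhancedState)
    (h : ∀ e, X.state.mult m e = if X.labelAt e then 0 else 1) :
    monomial X.state m = Pi.single X 1 := by
  classical
  funext Y
  rw [monomial, Pi.single_apply]
  refine if_congr ⟨fun hY => ?_, ?_⟩ rfl rfl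
  · refine EnhancedState.ext_labelAt hY.1 fun e => ?_
    have h1 := hY.2 e
    rw [h e] at h1
    revert h1
    cases X.labelAt e <;> cases Y.labelAt e <;> simp
  · rintro rfl
    exact ⟨rfl, h⟩

theorem exists_single_eq_monomial [IsEmpty (Fin D.loops)] (X : D.EnhancedState) :
    ∃ m, Pi.single X 1 = monomial X.state m := by
  classical
  let rep : D.Ends → D.Ends := fun e => (Quot.mk X.state.toPartial.Adj e).out
  have hrep : ∀ e, X.state.Rel (rep e) e := fun e => Quot.out_eq _
  have hrep' : ∀ e e', X.state.Rel e e' → rep e = rep e' := fun e e' h => congrArg Quot.out h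
  refine ⟨fun e => if rep e = e ∧ X.labelAt e = false then 1 else 0,
    (monomial_eq_single X fun e => ?_).symm⟩
  rw [State.mult, Finset.sum_eq_single (rep e)]
  · rw [if_pos (hrep e), EnhancedState.labelAt_congr (hrep e), hrep' _ _ (hrep e)]
    cases X.labelAt e <;> simp
  · intro a _ ha
    split_ifs with h1 h2
    · exact absurd ((h2.1.symm.trans (hrep' _ _ h1))) ha
    · rfl
    · rfl
  · simp

theorem exists_eq_of_mult_le_one [IsEmpty (Fin D.loops)] (h : ∀ e, S.mult m e ≤ 1) :
    ∃ X : D.EnhancedState, X.state = S ∧ ∀ e, S.mult m e = if X.labelAt e then 0 else 1 := by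
  refine ⟨EnhancedState.ofEnds S (fun e => decide (S.mult m e = 0)) fun e e' he => by
    rw [State.mult_congr he], rfl, fun e => ?_⟩
  rw [EnhancedState.labelAt_ofEnds]
  have := h e
  by_cases h0 : S.mult m e = 0
  · simp [h0]
  · simp only [h0]
    simp
    omega

theorem localD_apply_single (X Y : D.EnhancedState) [Decidable (EnhancedState.IsStep X Y c)] :
    localD c (Pi.single X 1) Y =
      if EnhancedState.IsStep X Y c then EnhancedState.localCoeff X Y c else 0 := by
  classical
  rw [localD, Matrix.mulVecLin_apply, Matrix.mulVec_single_one, Matrix.col_apply, Matrix.of_apply]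
  congr

theorem localD_monomial_of_true (hc : S c = true) : localD c (monomial S m) = 0 := by
  classical
  funext Y
  refine Finset.sum_eq_zero fun X _ => ?_
  change (if EnhancedState.IsStep X Y c then EnhancedState.localCoeff X Y c else 0) *
    monomial S m X = 0
  by_cases hX : X.state = S
  · have hs : ¬ EnhancedState.IsStep X Y c := fun h => by
      rw [← hX, h.1] at hc
      exact Bool.false_ne_true hc
    rw [if_neg hs, zero_mul]
  · rw [show monomial S m X = 0 from if_neg fun h => hX h.1, mul_zero]

theorem forall_ends_iff (S : D.State) (c : Fin D.n) {p : D.Ends → Prop}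
    (hp : ∀ e e', S.Rel e e' → (p e ↔ p e')) :
    (∀ e, p e) ↔ (∀ e, ¬ S.Through c e → p e) ∧ p (c, 0) ∧ p (c, 2) := by
  refine ⟨fun h => ⟨fun e _ => h e, h _, h _⟩, fun h e => ?_⟩
  by_cases he : S.Through c e
  · exact he.elim (fun h' => (hp _ _ h').mpr h.2.1) (fun h' => (hp _ _ h').mpr h.2.2)
  · exact h.1 e he

theorem mult_eq_iff_congr (X : D.EnhancedState) (hX : X.state = S) (e e' : D.Ends)
    (h : S.Rel e e') : (S.mult m e = if X.labelAt e then 0 else 1) ↔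
      S.mult m e' = if X.labelAt e' then 0 else 1 := by
  subst hX
  rw [State.mult_congr h, EnhancedState.labelAt_congr h]

open Classical in
theorem monomial_apply (S : D.State) (m : D.Ends → ℕ) (c : Fin D.n) (Y : D.EnhancedState) :
    monomial S m Y = if Y.state = S ∧
      (∀ e, ¬ S.Through c e → S.mult m e = if Y.labelAt e then 0 else 1) ∧
      (S.mult m (c, 0) = if Y.labelAt (c, 0) then 0 else 1) ∧
      (S.mult m (c, 2) = if Y.labelAt (c, 2) then 0 else 1) then 1 else 0 :=
  if_congr (and_congr_right fun h => forall_ends_iff S c (mult_eq_iff_congr Y h)) rfl rfl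

/-- If two circles are merged, then their variables become equal. -/
theorem localD_monomial_of_isMerge [IsEmpty (Fin D.loops)] (hc : S c = false)
    (hS : S' = Function.update S c true) (h : S.IsMerge S' c) :
    localD c (monomial S m) = monomial S' m := by
  classical
  by_cases hm : ∀ e, S.mult m e ≤ 1
  · obtain ⟨X, rfl, hX⟩ := exists_eq_of_mult_le_one hm
    rw [monomial_eq_single X hX]
    funext Y
    rw [localD_apply_single, monomial_apply _ _ c]
    by_cases hY : Y.state = S'
    · subst hY
      have hst : EnhancedState.IsStep X Y c ↔
          ∀ e, ¬ X.state.Through c e → Y.labelAt e = X.labelAt e := by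
        rw [EnhancedState.isStep_iff]
        exact ⟨fun h => h.2.2, fun h => ⟨hc, hS, h⟩⟩
      have hoff : (∀ e, ¬ Y.state.Through c e → Y.state.mult m e = if Y.labelAt e then 0 else 1) ↔
          ∀ e, ¬ X.state.Through c e → Y.labelAt e = X.labelAt e := by
        refine forall_congr' fun e => ?_
        rw [h.through_iff]
        refine forall_congr' fun he => ?_
        rw [h.mult_of_not_through he, hX]
        cases X.labelAt e <;> cases Y.labelAt e <;> simp
      rw [EnhancedState.localCoeff_of_isMerge h]
      simp only [hst, hoff, true_and, h.mult_self, EnhancedState.labelAt_congr h.rel.symm, hX]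
      by_cases hP : ∀ e, ¬ X.state.Through c e → Y.labelAt e = X.labelAt e
      · simp only [eq_true hP, true_and]
        cases X.labelAt (c, 0) <;> cases X.labelAt (c, 2) <;> cases Y.labelAt (c, 0) <;>
          simp [mulCoeff]
      · simp only [eq_false hP, false_and, if_false]
    · rw [if_neg fun h' => hY (h'.2.1.trans hS.symm), if_neg fun h' => hY h'.1]
  · push Not at hm
    obtain ⟨e, he⟩ := hm
    rw [monomial_eq_zero he, map_zero]
    by_cases ht : S.Through c e
    · refine (monomial_eq_zero (e := (c, 0)) ?_).symm
      rw [h.mult_self]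
      rcases ht with ht | ht <;> rw [State.mult_congr ht] at he <;> omega
    · exact (monomial_eq_zero (e := e) (by rw [h.mult_of_not_through ht]; omega)).symm

/-- If a circle is split, then the monomial is multiplied by the sum of the variables of the two
resulting circles. -/
theorem localD_monomial_of_isMerge' [IsEmpty (Fin D.loops)] (hc : S c = false)
    (hS : S' = Function.update S c true) (h : S'.IsMerge S c) :
    localD c (monomial S m) =
      monomial S' (m + Pi.single (c, 0) 1) + monomial S' (m + Pi.single (c, 2) 1) := by
  classical
  have h02 := h.not_rel
  have h20 : ¬ S'.Rel (c, 2) (c, 0) := fun h' => h02 h'.symm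
  have m00 := State.mult_add_single_of_rel (m := m) (State.Rel.refl S' (c, 0))
  have m02 := State.mult_add_single_of_not_rel (m := m) h02
  have m20 := State.mult_add_single_of_not_rel (m := m) h20
  have m22 := State.mult_add_single_of_rel (m := m) (State.Rel.refl S' (c, 2))
  have moff : ∀ e, ¬ S'.Through c e →
      S'.mult (m + Pi.single (c, 0) 1) e = S.mult m e ∧
      S'.mult (m + Pi.single (c, 2) 1) e = S.mult m e := fun e he => by
    rw [h.mult_of_not_through he,
      State.mult_add_single_of_not_rel fun h' => he (Or.inl h'.symm),
      State.mult_add_single_of_not_rel fun h' => he (Or.inr h'.symm)]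
    exact ⟨rfl, rfl⟩
  by_cases hm : ∀ e, S.mult m e ≤ 1
  · obtain ⟨X, rfl, hX⟩ := exists_eq_of_mult_le_one hm
    rw [monomial_eq_single X hX]
    funext Y
    rw [localD_apply_single, Pi.add_apply, monomial_apply _ _ c, monomial_apply _ _ c]
    by_cases hY : Y.state = S'
    · subst hY
      have hst : EnhancedState.IsStep X Y c ↔
          ∀ e, ¬ X.state.Through c e → Y.labelAt e = X.labelAt e := by
        rw [EnhancedState.isStep_iff]
        exact ⟨fun h => h.2.2, fun h => ⟨hc, hS, h⟩⟩
      have hoff : ∀ m' : D.Ends → ℕ, (∀ e, ¬ Y.state.Through c e →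
          Y.state.mult m' e = X.state.mult m e) →
          ((∀ e, ¬ Y.state.Through c e → Y.state.mult m' e = if Y.labelAt e then 0 else 1) ↔
          ∀ e, ¬ X.state.Through c e → Y.labelAt e = X.labelAt e) := by
        intro m' hm'
        refine forall_congr' fun e => ?_
        rw [h.through_iff]
        refine forall_congr' fun he => ?_
        rw [hm' e he, hX]
        cases X.labelAt e <;> cases Y.labelAt e <;> simp
      have hself := h.mult_self (m := m) 0
      rw [hX] at hself
      rw [EnhancedState.localCoeff_of_isMerge' h]
      simp only [hst, hoff _ fun e he => (moff e he).1, hoff _ fun e he => (moff e he).2, true_and,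
        m00, m02, m20, m22]
      by_cases hP : ∀ e, ¬ X.state.Through c e → Y.labelAt e = X.labelAt e
      · simp only [eq_true hP, true_and]
        revert hself
        generalize Y.state.mult m (c, 0) = x
        generalize Y.state.mult m (c, 2) = y
        cases X.labelAt (c, 0) <;> cases Y.labelAt (c, 0) <;> cases Y.labelAt (c, 2) <;>
          simp [comulCoeff] <;> grind
      · simp only [eq_false hP, false_and, if_false, add_zero]
    · rw [if_neg fun h' => hY (h'.2.1.trans hS.symm), if_neg fun h' => hY h'.1,
        if_neg fun h' => hY h'.1, add_zero]
  · push Not at hm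
    obtain ⟨e, he⟩ := hm
    rw [monomial_eq_zero he, map_zero]
    symm
    by_cases ht : S'.Through c e
    · have he' : 2 ≤ S'.mult m (c, 0) + S'.mult m (c, 2) := by
        rw [← h.mult_self 0]
        rwa [State.mult_congr (h.rel_zero_iff.mpr ht)] at he
      by_cases h0 : S'.mult m (c, 0) = 0
      · rw [monomial_eq_zero (e := (c, 2)) (by omega), monomial_eq_zero (e := (c, 2)) (by omega),
          add_zero]
      · by_cases h2 : S'.mult m (c, 2) = 0
        · rw [monomial_eq_zero (e := (c, 0)) (by omega),
            monomial_eq_zero (e := (c, 0)) (by omega), add_zero]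
        · rw [monomial_eq_zero (e := (c, 0)) (by omega),
            monomial_eq_zero (e := (c, 2)) (by omega), add_zero]
    · rw [monomial_eq_zero (e := e) (by rw [(moff e ht).1]; omega),
        monomial_eq_zero (e := e) (by rw [(moff e ht).2]; omega), add_zero]

theorem monomial_add_single_congr (h : S.Rel e e') :
    monomial S (m + Pi.single e 1) = monomial S (m + Pi.single e' 1) := by
  have : ∀ a, S.mult (m + Pi.single e 1) a = S.mult (m + Pi.single e' 1) a := by
    intro a
    by_cases ha : S.Rel e a
    · rw [State.mult_add_single_of_rel ha, State.mult_add_single_of_rel (h.symm.trans ha)]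
    · rw [State.mult_add_single_of_not_rel ha,
        State.mult_add_single_of_not_rel fun h' => ha (h.trans h')]
  funext X
  simp only [monomial, this]

/-- The changes of two smoothings commute. -/
theorem localD_localD_monomial [IsEmpty (Fin D.loops)] (hne : c ≠ c') (hc : S c = false)
    (hc' : S c' = false) :
    localD c' (localD c (monomial S m)) = localD c (localD c' (monomial S m)) := by
  obtain ⟨S₁, hS₁⟩ : ∃ S₁ : D.State, S₁ = Function.update S c true := ⟨_, rfl⟩
  obtain ⟨S₂, hS₂⟩ : ∃ S₂ : D.State, S₂ = Function.update S c' true := ⟨_, rfl⟩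
  obtain ⟨T, hT₁⟩ : ∃ T : D.State, T = Function.update S₁ c' true := ⟨_, rfl⟩
  have hT₂ : T = Function.update S₂ c true := by
    rw [hT₁, hS₁, hS₂, Function.update_comm hne]
  have hc₁ : S₁ c' = false := by rw [hS₁, Function.update_of_ne hne.symm, hc']
  have hc₂ : S₂ c = false := by rw [hS₂, Function.update_of_ne hne, hc]
  rcases State.isMerge_or_isMerge S S₁ c false hc hS₁ with h1 | h1 <;>
  rcases State.isMerge_or_isMerge S₁ T c' false hc₁ hT₁ with h1' | h1' <;>
  rcases State.isMerge_or_isMerge S S₂ c' false hc' hS₂ with h2 | h2 <;>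
  rcases State.isMerge_or_isMerge S₂ T c false hc₂ hT₂ with h2' | h2' <;>
  have k1 := h1.card_circles <;> have k1' := h1'.card_circles <;>
  have k2 := h2.card_circles <;> have k2' := h2'.card_circles <;>
  -- The two sides of the square change the number of circles by the same amount.
  first
    | (exfalso; omega)
    | skip
  all_goals
    first
      | rw [localD_monomial_of_isMerge hc hS₁ h1]
      | rw [localD_monomial_of_isMerge' hc hS₁ h1]
    first
      | rw [localD_monomial_of_isMerge hc' hS₂ h2]
      | rw [localD_monomial_of_isMerge' hc' hS₂ h2]
  all_goals
    try simp only [map_add]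
    first
      | simp only [localD_monomial_of_isMerge hc₁ hT₁ h1']
      | simp only [localD_monomial_of_isMerge' hc₁ hT₁ h1']
    first
      | simp only [localD_monomial_of_isMerge hc₂ hT₂ h2']
      | simp only [localD_monomial_of_isMerge' hc₂ hT₂ h2']
  · -- Both changes split the circle obtained by first merging two circles.
    have hthrough : ∀ k, T.Through c' (c, k) := by
      have hcc : S₁.Rel (c, 0) (c', 0) := by
        by_contra hcc
        have := (h1'.rel_iff (e := (c, 0)) (e' := (c, 2))).mp h1.rel
        rcases this with h | h
        · exact h2'.not_rel h
        · exact hcc (h1'.rel_zero_iff.mpr h.1)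
      intro k
      rw [← h1'.rel_zero_iff]
      exact (State.rel_of_rel_zero_two h1.rel k 0).trans hcc
    rcases hthrough 0 with h0 | h0 <;> rcases hthrough 2 with h2'' | h2''
    · exact absurd (h0.trans h2''.symm) h2'.not_rel
    · rw [monomial_add_single_congr h0, monomial_add_single_congr h2'']
    · rw [monomial_add_single_congr h0, monomial_add_single_congr h2'', add_comm]
    · exact absurd (h0.trans h2''.symm) h2'.not_rel
  · -- A circle is split by either change and restored by the other one.
    have hc0 : T.Rel (c, 0) (c', 0) := by
      rcases h1'.rel_iff.mp h2'.rel with h | h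
      · exact absurd h h1.not_rel
      · exact h1'.rel_zero_iff.mpr h.1
    rw [monomial_add_single_congr (h2'.rel.symm.trans hc0), monomial_add_single_congr hc0,
      monomial_add_single_congr h1'.rel.symm]
  · simp only [add_right_comm m]
    abel

theorem State.sign_update (hc : S c = false) :
    State.sign (Function.update S c true) c' = (if c < c' then -1 else 1) * S.sign c' := by
  rw [sign, sign]
  split_ifs with h
  · have : (Finset.univ.filter fun a => a < c' ∧ Function.update S c true a = true) =
        insert c (Finset.univ.filter fun a => a < c' ∧ S a = true) := by
      ext a
      by_cases ha : a = c
      · subst ha; simp [h]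
      · simp [ha]
    rw [this, Finset.card_insert_of_notMem (by simp [hc]), pow_succ, mul_comm]
  · rw [one_mul]
    congr 2
    ext a
    by_cases ha : a = c
    · subst ha; simp [h]
    · simp [ha]

theorem d_monomial (S : D.State) (m : D.Ends → ℕ) :
    D.d (monomial S m) = ∑ c, S.sign c • localD c (monomial S m) := by
  classical
  funext Y
  rw [Finset.sum_apply]
  change ∑ X, EnhancedState.coeff X Y * monomial S m X =
    ∑ c, S.sign c * ∑ X, _ * monomial S m X
  simp only [Finset.mul_sum]
  rw [Finset.sum_comm]
  refine Finset.sum_congr rfl fun X _ => ?_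
  by_cases hX : X.state = S
  · subst hX
    rw [EnhancedState.coeff, Finset.sum_mul]
    refine Finset.sum_congr rfl fun c _ => ?_
    rw [Matrix.of_apply, State.sign]
    split_ifs <;> ring
  · simp only [monomial, hX, false_and, if_false, mul_zero, Finset.sum_const_zero]

theorem localD_monomial_induction [IsEmpty (Fin D.loops)] {p : D.Chain → Prop} (hc : S c = false)
    (hp : ∀ m, p (monomial (Function.update S c true) m)) (hadd : ∀ x y, p x → p y → p (x + y)) :
    p (localD c (monomial S m)) := by
  rcases State.isMerge_or_isMerge S _ c false hc rfl with h | h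
  · rw [localD_monomial_of_isMerge hc rfl h]
    exact hp _
  · rw [localD_monomial_of_isMerge' hc rfl h]
    exact hadd _ _ (hp _) (hp _)

theorem d_localD_monomial [IsEmpty (Fin D.loops)] (hc : S c = false) :
    D.d (localD c (monomial S m)) =
      ∑ c', State.sign (Function.update S c true) c' • localD c' (localD c (monomial S m)) := by
  refine localD_monomial_induction (p := fun x => D.d x =
    ∑ c', State.sign (Function.update S c true) c' • localD c' x) hc (d_monomial _) ?_
  intro x y hx hy
  rw [map_add, hx, hy, ← Finset.sum_add_distrib]
  exact Finset.sum_congr rfl fun c' _ => by rw [map_add, smul_add]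

theorem localD_localD_of_true [IsEmpty (Fin D.loops)] (hc : S c = false)
    (hc' : Function.update S c true c' = true) : localD c' (localD c (monomial S m)) = 0 := by
  refine localD_monomial_induction (p := fun x => localD c' x = 0) hc
    (fun m => localD_monomial_of_true hc') ?_
  intro x y hx hy
  rw [map_add, hx, hy, add_zero]

theorem d_d_monomial [IsEmpty (Fin D.loops)] (S : D.State) (m : D.Ends → ℕ) :
    D.d (D.d (monomial S m)) = 0 := by
  let f : Fin D.n → Fin D.n → D.Chain := fun c c' => if S c = false then
    S.sign c • State.sign (Function.update S c true) c' • localD c' (localD c (monomial S m)) else 0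
  have h1 : D.d (D.d (monomial S m)) = ∑ c, ∑ c', f c c' := by
    rw [d_monomial, map_sum]
    refine Finset.sum_congr rfl fun c _ => ?_
    rw [map_smul]
    rcases hc : S c with _ | _
    · simp only [f, hc, if_true, d_localD_monomial hc, Finset.smul_sum]
    · simp [f, hc, localD_monomial_of_true hc]
  have h2 : ∀ c c', f c c' = - f c' c := by
    intro c c'
    rcases hc : S c with _ | _
    · rcases hc' : S c' with _ | _
      · by_cases hne : c = c'
        · subst hne
          simp [f, hc, localD_localD_of_true hc (c' := c)]
        · simp only [f, hc, hc', if_true]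
          rw [State.sign_update hc, State.sign_update hc', localD_localD_monomial hne hc hc',
            smul_smul, smul_smul, ← neg_smul]
          congr 1
          rcases lt_or_gt_of_ne hne with h | h
          · rw [if_pos h, if_neg h.not_gt]; ring
          · rw [if_pos h, if_neg h.not_gt]; ring
      · have hne : c' ≠ c := by rintro rfl; rw [hc] at hc'; cases hc'
        simp [f, hc, hc', localD_localD_of_true hc (c' := c')
          (by rw [Function.update_of_ne hne, hc'])]
    · rcases hc' : S c' with _ | _
      · have hne : c ≠ c' := by rintro rfl; rw [hc] at hc'; cases hc'
        simp [f, hc, hc', localD_localD_of_true hc' (c' := c)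
          (by rw [Function.update_of_ne hne, hc])]
      · simp [f, hc, hc']
  rw [h1]
  have h3 : ∑ c, ∑ c', f c c' = - ∑ c, ∑ c', f c c' := by
    conv_lhs => rw [Finset.sum_comm]
    simp only [← Finset.sum_neg_distrib]
    exact Finset.sum_congr rfl fun c _ => Finset.sum_congr rfl fun c' _ => h2 c' c
  exact self_eq_neg.mp h3

end Monomial

/-- The Khovanov complex is a complex. -/
theorem d_comp_d [IsEmpty (Fin D.loops)] : D.d ∘ₗ D.d = 0 := by
  classical
  refine LinearMap.pi_ext' fun X => LinearMap.ext_ring ?_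
  obtain ⟨m, hm⟩ := exists_single_eq_monomial X
  simp only [LinearMap.comp_apply, LinearMap.coe_single, LinearMap.zero_apply]
  rw [hm, d_d_monomial]

end LinkDiagram

/-! ### Matchings in a complex of free abelian groups -/

namespace MatchingBound

open Module

theorem finrank_range_add_finrank_ker_int {M N : Type} [AddCommGroup M] [AddCommGroup N]
    [Module.Finite ℤ M] (f : M →ₗ[ℤ] N) :
    finrank ℤ (LinearMap.range f) + finrank ℤ (LinearMap.ker f) = finrank ℤ M := by
  have h := LinearMap.rank_range_add_rank_ker f
  rw [← Module.finrank_eq_rank, ← Module.finrank_eq_rank, ← Module.finrank_eq_rank] at h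
  exact_mod_cast h

variable {ι : Type} [Fintype ι]

/-- The functions vanishing outside of `A`. -/
def supported (A : Set ι) : Submodule ℤ (ι → ℤ) where
  carrier := {f | ∀ x, f x ≠ 0 → x ∈ A}
  add_mem' := by
    intro f g hf hg x hx
    by_cases h : f x = 0
    · exact hg x fun h' => hx (by simp [h, h'])
    · exact hf x h
  zero_mem' := by
    intro x hx
    simp at hx
  smul_mem' := by
    intro a f hf x hx
    exact hf x fun h => hx (by simp [h])

/-- The homology classes of the cycles which vanish outside of `A`. -/
def homologyOn (f : (ι → ℤ) →ₗ[ℤ] (ι → ℤ)) (A : Set ι) :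
    Submodule ℤ (LinearMap.ker f ⧸ (LinearMap.range f).submoduleOf (LinearMap.ker f)) :=
  ((supported A).submoduleOf (LinearMap.ker f)).map
    ((LinearMap.range f).submoduleOf (LinearMap.ker f)).mkQ

variable {f : (ι → ℤ) →ₗ[ℤ] (ι → ℤ)} {A A₀ X Y : Set ι}

theorem finrank_supported_le (A : Set ι) : finrank ℤ (supported A) ≤ A.ncard := by
  classical
  let g : supported A →ₗ[ℤ] (A → ℤ) :=
    (LinearMap.funLeft ℤ ℤ (Subtype.val : A → ι)) ∘ₗ (supported A).subtype
  have hg : Function.Injective g := by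
    intro a b hab
    ext x
    by_cases hx : x ∈ A
    · exact congrFun hab ⟨x, hx⟩
    · rw [not_not.mp fun h => hx (a.2 x h), not_not.mp fun h => hx (b.2 x h)]
  have h := LinearMap.finrank_le_finrank_of_injective hg
  rwa [finrank_fintype_fun_eq_card, ← Nat.card_eq_fintype_card, Nat.card_coe_set_eq] at h

/-- The images of the basis elements in `X` are linearly independent, because the matrix of their
coefficients at their mates is triangular. -/
theorem linearIndependent_of_triangular [DecidableEq ι] {β : Type*} [LinearOrder β]
    (mate : ι → ι) (Φ : ι → β)
    (hne : ∀ x ∈ X, f (Pi.single x 1) (mate x) ≠ 0)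
    (htri : ∀ x ∈ X, ∀ x' ∈ X, f (Pi.single x 1) (mate x') ≠ 0 → x = x' ∨ Φ x' < Φ x) :
    LinearIndependent ℤ fun x : X => f (Pi.single x.1 1) := by
  classical
  rw [Fintype.linearIndependent_iff]
  intro a ha
  by_contra! hex
  obtain ⟨x, hx, hmax⟩ := Finset.exists_max_image (Finset.univ.filter fun x : X => a x ≠ 0)
    (fun x => Φ x.1) (by obtain ⟨x, hx⟩ := hex; exact ⟨x, by simpa using hx⟩)
  have hx0 : a x ≠ 0 := by simpa using hx
  have h := congrFun ha (mate x.1)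
  rw [Finset.sum_apply, Finset.sum_eq_single x] at h
  · simp only [Pi.smul_apply, smul_eq_mul, Pi.zero_apply, mul_eq_zero] at h
    exact h.elim hx0 (hne x.1 x.2)
  · intro y _ hyx
    by_cases hy : a y = 0
    · simp [hy]
    · have h0 : f (Pi.single y.1 1) (mate x.1) = 0 := by
        by_contra h0
        rcases htri y.1 y.2 x.1 x.2 h0 with h1 | h1
        · exact hyx (Subtype.ext h1)
        · exact absurd (hmax y (by simpa using hy)) h1.not_ge
      simp [h0]
  · simp

theorem ncard_le_finrank_map [DecidableEq ι]
    (hX : LinearIndependent ℤ fun x : X => f (Pi.single x.1 1)) (A : Set ι) :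
    (X ∩ A).ncard ≤ finrank ℤ ((supported A).map f) := by
  classical
  have hli : LinearIndependent ℤ fun x : ↥(X ∩ A) => f (Pi.single x.1 1) :=
    hX.comp (fun x : ↥(X ∩ A) => (⟨x.1, x.2.1⟩ : X))
      fun x y hxy => Subtype.ext (congrArg (fun z : X => z.1) hxy)
  rw [← Nat.card_coe_set_eq, Nat.card_eq_fintype_card, ← finrank_span_eq_card hli]
  refine Submodule.finrank_mono (Submodule.span_le.mpr ?_)
  rintro _ ⟨x, rfl⟩
  refine ⟨Pi.single x.1 1, fun y hy => ?_, rfl⟩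
  by_cases hyx : y = x.1
  · exact hyx ▸ x.2.2
  · exact absurd (Pi.single_eq_of_ne hyx 1) hy

theorem finrank_homologyOn_add_le (hff : f ∘ₗ f = 0)
    (hA : (supported A₀).map f ≤ supported A) :
    finrank ℤ (homologyOn f A) + finrank ℤ ((supported A₀).map f) +
      finrank ℤ ((supported A).map f) ≤ finrank ℤ (supported A) := by
  set N := (supported A).submoduleOf (LinearMap.ker f) with hN
  let q := ((LinearMap.range f).submoduleOf (LinearMap.ker f)).mkQ ∘ₗ N.subtype
  have h1 := finrank_range_add_finrank_ker_int q
  have h2 := finrank_range_add_finrank_ker_int (f ∘ₗ (supported A).subtype)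
  have hq : LinearMap.range q = homologyOn f A := by
    rw [LinearMap.range_comp, Submodule.range_subtype, homologyOn]
  have hr : LinearMap.range (f ∘ₗ (supported A).subtype) = (supported A).map f := by
    rw [LinearMap.range_comp, Submodule.range_subtype]
  rw [hq] at h1
  rw [hr] at h2
  have hmap : (LinearMap.ker (f ∘ₗ (supported A).subtype)).map (supported A).subtype =
      N.map (LinearMap.ker f).subtype := by
    ext x
    simp [hN, Submodule.submoduleOf, and_comm]
  have h3 : finrank ℤ (LinearMap.ker (f ∘ₗ (supported A).subtype)) = finrank ℤ N := by
    rw [(Submodule.equivMapOfInjective _ (supported A).injective_subtype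
        (LinearMap.ker (f ∘ₗ (supported A).subtype))).finrank_eq,
      (Submodule.equivMapOfInjective _ (LinearMap.ker f).injective_subtype N).finrank_eq, hmap]
  have h4 : finrank ℤ ((supported A₀).map f) ≤ finrank ℤ (LinearMap.ker q) := by
    have hinj : Function.Injective ((LinearMap.ker f).subtype ∘ₗ N.subtype) :=
      (LinearMap.ker f).injective_subtype.comp N.injective_subtype
    rw [(Submodule.equivMapOfInjective _ hinj (LinearMap.ker q)).finrank_eq]
    refine Submodule.finrank_mono ?_
    rintro _ ⟨g, hg, rfl⟩
    have hker : f g ∈ LinearMap.ker f := LinearMap.congr_fun hff g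
    refine ⟨⟨⟨f g, hker⟩, hA ⟨g, hg, rfl⟩⟩, ?_, rfl⟩
    change Submodule.Quotient.mk _ = 0
    rw [Submodule.Quotient.mk_eq_zero]
    exact ⟨g, rfl⟩
  omega

/-- The rank of the homology is bounded by the number of unmatched basis elements, for a matching
between `X` and `Y` with a triangular matrix of coefficients. -/
theorem finrank_homologyOn_le [DecidableEq ι] {β : Type*} [LinearOrder β] (hff : f ∘ₗ f = 0)
    (mate : ι → ι) (Φ : ι → β)
    (hne : ∀ x ∈ X, f (Pi.single x 1) (mate x) ≠ 0)
    (htri : ∀ x ∈ X, ∀ x' ∈ X, f (Pi.single x 1) (mate x') ≠ 0 → x = x' ∨ Φ x' < Φ x)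
    (hA : ∀ x ∈ A₀, ∀ y, f (Pi.single x 1) y ≠ 0 → y ∈ A)
    (hY : ∀ y ∈ Y ∩ A, ∃ x ∈ X ∩ A₀, mate x = y) :
    finrank ℤ (homologyOn f A) ≤ (A \ (X ∪ Y)).ncard := by
  classical
  have hmap : (supported A₀).map f ≤ supported A := by
    rintro _ ⟨g, hg, rfl⟩ y hy
    rw [pi_eq_sum_univ' g] at hy
    simp only [map_sum, map_smul, Finset.sum_apply] at hy
    obtain ⟨x, -, hx⟩ := Finset.exists_ne_zero_of_sum_ne_zero hy
    simp only [Pi.smul_apply, smul_eq_mul, ne_eq, mul_eq_zero, not_or] at hx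
    exact hA x (hg x hx.1) y hx.2
  have hli := linearIndependent_of_triangular mate Φ hne htri
  have h1 := ncard_le_finrank_map hli A
  have h2 := ncard_le_finrank_map hli A₀
  have h3 := finrank_homologyOn_add_le hff hmap
  have h4 := finrank_supported_le A
  have h5 : (Y ∩ A).ncard ≤ (X ∩ A₀).ncard := by
    refine le_trans (Set.ncard_le_ncard (t := mate '' (X ∩ A₀)) ?_ (Set.toFinite _))
      (Set.ncard_image_le (Set.toFinite _))
    intro y hy
    obtain ⟨x, hx, rfl⟩ := hY y hy
    exact ⟨x, hx, rfl⟩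
  have h6 : A.ncard ≤ (X ∩ A).ncard + (Y ∩ A).ncard + (A \ (X ∪ Y)).ncard := by
    have : A = (X ∩ A) ∪ (Y ∩ A) ∪ (A \ (X ∪ Y)) := by
      ext x
      simp only [Set.mem_union, Set.mem_inter_iff, Set.mem_sdiff]
      tauto
    conv_lhs => rw [this]
    exact (Set.ncard_union_le _ _).trans (Nat.add_le_add_right (Set.ncard_union_le _ _) _)
  omega

theorem rank_rat_tensor (M : Type) [AddCommGroup M] [Module.Finite ℤ M] :
    Module.rank ℚ (TensorProduct ℤ ℚ M) = (finrank ℤ M : Cardinal) := by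
  rw [Module.finrank_eq_rank]
  exact (TensorProduct.isBaseChange ℤ M ℚ).rank_eq

end MatchingBound

namespace LinkDiagram

variable {D : LinkDiagram}

/-! ### Diagrams all of whose crossings are nugatory -/

namespace PartialState

variable {σ : D.PartialState} {c c' : Fin D.n} {e e' e₀ : D.Ends} {b : Bool}

/-- The diagram `σ` is connected and each of its crossings is nugatory: one of the smoothings of the
crossing separates its ends 0 and 2, which amounts to disconnecting the diagram. -/
structure IsReduced (σ : D.PartialState) : Prop where
  rel : ∀ e e', σ.Rel e e'
  exists_not_rel : ∀ c, σ c = none →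
    ∃ b, ¬ PartialState.Rel (Function.update σ c (some b)) (c, 0) (c, 2)

open Classical in
/-- For a crossing of a reduced diagram, the smoothing which disconnects the diagram. -/
noncomputable def cutType (σ : D.PartialState) (c : Fin D.n) : Bool :=
  if PartialState.Rel (Function.update σ c (some true)) (c, 0) (c, 2) then false else true

/-- The diagram cut into two pieces at the crossing `c`. -/
noncomputable def cut (σ : D.PartialState) (c : Fin D.n) : D.PartialState :=
  Function.update σ c (some (σ.cutType c))

open Classical in
/-- The number 0 or 2 of an end at `c` which is separated from the base end `e₀` by cutting the
diagram at `c`. -/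
noncomputable def far (σ : D.PartialState) (e₀ : D.Ends) (c : Fin D.n) : Fin 4 :=
  if (σ.cut c).Rel e₀ (c, 0) then 2 else 0

open Classical in
/-- The number 0 or 2 of an end at `c` which remains connected with the base end `e₀` when the
diagram is cut at `c`. -/
noncomputable def near (σ : D.PartialState) (e₀ : D.Ends) (c : Fin D.n) : Fin 4 :=
  if (σ.cut c).Rel e₀ (c, 0) then 0 else 2

theorem far_near (σ : D.PartialState) (e₀ : D.Ends) (c : Fin D.n) :
    (σ.far e₀ c = 0 ∧ σ.near e₀ c = 2) ∨ (σ.far e₀ c = 2 ∧ σ.near e₀ c = 0) := by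
  unfold far near
  split_ifs <;> simp

theorem cut_apply_self (σ : D.PartialState) (c : Fin D.n) : σ.cut c c = some (σ.cutType c) := by
  simp [cut]

theorem cut_apply_of_ne (h : c' ≠ c) : σ.cut c c' = σ c' := by
  simp [cut, h]

theorem IsReduced.not_rel (hσ : σ.IsReduced) (hc : σ c = none) :
    ¬ (σ.cut c).Rel (c, 0) (c, 2) := by
  obtain ⟨b, hb⟩ := hσ.exists_not_rel c hc
  unfold cut cutType
  split_ifs with h
  · cases b
    · exact hb
    · exact absurd h hb
  · exact h

theorem cut_rel_zero_or_two (σ : D.PartialState) (c : Fin D.n) (k : Fin 4) :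
    (σ.cut c).Rel (c, k) (c, 0) ∨ (σ.cut c).Rel (c, k) (c, 2) := by
  have h := Rel.partner (σ.cut_apply_self c) k
  generalize σ.cutType c = b at h
  fin_cases k
  · exact Or.inl (Rel.refl _ _)
  · cases b
    · exact Or.inl h
    · exact Or.inr h
  · exact Or.inr (Rel.refl _ _)
  · cases b
    · exact Or.inr h
    · exact Or.inl h

/-- Every end is on one of the two sides of a crossing. -/
theorem IsReduced.rel_zero_or_two (hσ : σ.IsReduced) (e : D.Ends) :
    (σ.cut c).Rel e (c, 0) ∨ (σ.cut c).Rel e (c, 2) := by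
  have hstep : ∀ a a', (σ.cut c).Rel a a' →
      ((σ.cut c).Rel a (c, 0) ∨ (σ.cut c).Rel a (c, 2)) =
      ((σ.cut c).Rel a' (c, 0) ∨ (σ.cut c).Rel a' (c, 2)) := fun a a' h =>
    propext (or_congr ⟨h.symm.trans, h.trans⟩ ⟨h.symm.trans, h.trans⟩)
  have key := (hσ.rel (c, 0) e).apply_eq
    (fun a => (σ.cut c).Rel a (c, 0) ∨ (σ.cut c).Rel a (c, 2))
    (fun a => hstep _ _ (Rel.edge _ a).symm) ?_ ?_
  · exact key.mp (Or.inl (Rel.refl _ _))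
  · intro c' b hb k
    by_cases hcc : c' = c
    · subst hcc
      exact propext (iff_of_true (cut_rel_zero_or_two _ _ _) (cut_rel_zero_or_two _ _ _))
    · exact hstep _ _ (Rel.partner (by rwa [cut_apply_of_ne hcc]) k).symm
  · intro c' hc' k k'
    by_cases hcc : c' = c
    · subst hcc
      exact propext (iff_of_true (cut_rel_zero_or_two _ _ _) (cut_rel_zero_or_two _ _ _))
    · exact hstep _ _ (Rel.cross (by rwa [cut_apply_of_ne hcc]) k k')

theorem IsReduced.rel_near (hσ : σ.IsReduced) (e₀ : D.Ends) (c : Fin D.n) :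
    (σ.cut c).Rel e₀ (c, σ.near e₀ c) := by
  unfold near
  split_ifs with h
  · exact h
  · exact (hσ.rel_zero_or_two e₀).resolve_left h

theorem IsReduced.not_rel_far (hσ : σ.IsReduced) (hc : σ c = none) :
    ¬ (σ.cut c).Rel e₀ (c, σ.far e₀ c) := by
  unfold far
  split_ifs with h
  · exact fun h' => hσ.not_rel hc (h.symm.trans h')
  · exact h

/-- If the crossing `c'` is on the far side of `c`, then everything on the near side of `c` is
on the near side of `c'`. -/
theorem IsReduced.rel_cut_of_rel_cut (hcc : c ≠ c') (hc : σ c = none) (hc' : σ c' = none)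
    (hfar : ¬ (σ.cut c).Rel e₀ (c', 0)) (h : (σ.cut c).Rel e₀ e) : (σ.cut c').Rel e₀ e := by
  have hfar' : ∀ k, ¬ (σ.cut c).Rel e₀ (c', k) := fun k hk =>
    hfar (hk.trans (Rel.cross (by rw [cut_apply_of_ne hcc.symm, hc']) k 0))
  -- On the near side of `c`, every step in the diagram cut at `c` is one in that cut at `c'`.
  have hstep : ∀ a a', (σ.cut c).Rel a a' → ((σ.cut c).Rel e₀ a → (σ.cut c').Rel a a') →
      ((σ.cut c).Rel e₀ a ∧ (σ.cut c').Rel e₀ a) = ((σ.cut c).Rel e₀ a' ∧ (σ.cut c').Rel e₀ a') :=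
    fun a a' h1 h2 => propext
      ⟨fun h => ⟨h.1.trans h1, h.2.trans (h2 h.1)⟩,
        fun h => ⟨h.1.trans h1.symm, h.2.trans (h2 (h.1.trans h1.symm)).symm⟩⟩
  have key := h.apply_eq (fun a => (σ.cut c).Rel e₀ a ∧ (σ.cut c').Rel e₀ a)
    (fun a => (hstep _ _ (Rel.edge _ a) fun _ => Rel.edge _ a).symm) ?_ ?_
  · exact (key.mp ⟨Rel.refl _ _, Rel.refl _ _⟩).2
  · intro a b hb k
    refine (hstep _ _ (Rel.partner hb k) fun h0 => ?_).symm
    have hne : a ≠ c' := by rintro rfl; exact hfar' _ h0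
    by_cases hac : a = c
    · subst hac
      exact Rel.cross (by rw [cut_apply_of_ne hne, hc]) _ _
    · exact Rel.partner (by rw [cut_apply_of_ne hne, ← hb, cut_apply_of_ne hac]) _
  · intro a ha k k'
    refine hstep _ _ (Rel.cross ha k k') fun h0 => ?_
    have hne : a ≠ c' := by rintro rfl; exact hfar' _ h0
    have hac : a ≠ c := by rintro rfl; rw [cut_apply_self] at ha; cases ha
    exact Rel.cross (by rw [cut_apply_of_ne hne, ← ha, cut_apply_of_ne hac]) _ _

open Classical in
/-- The number of ends on the near side of the crossing `c`. It is smaller for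
crossings which separate `c` from the base end. -/
noncomputable def weight (σ : D.PartialState) (e₀ : D.Ends) (c : Fin D.n) : ℕ :=
  (Finset.univ.filter fun e => (σ.cut c).Rel e₀ e).card

theorem weight_pos (σ : D.PartialState) (e₀ : D.Ends) (c : Fin D.n) : 0 < σ.weight e₀ c := by
  classical
  exact Finset.card_pos.mpr ⟨e₀, by simpa using Rel.refl _ _⟩

section HasState

variable {S : D.State}

theorem HasState.rel_cut (hS : σ.HasState S) (hc : S c = σ.cutType c) (h : S.Rel e e') :
    (σ.cut c).Rel e e' := by
  refine HasState.rel (fun c' b hb => ?_) h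
  by_cases hcc : c' = c
  · subst hcc
    rw [cut_apply_self] at hb
    cases hb
    exact hc
  · exact hS c' b (by rwa [cut_apply_of_ne hcc] at hb)

theorem HasState.not_rel_zero_two (hσ : σ.IsReduced) (hS : σ.HasState S) (hc : σ c = none)
    (hSc : S c = σ.cutType c) : ¬ S.Rel (c, 0) (c, 2) := fun h =>
  hσ.not_rel hc (hS.rel_cut hSc h)

/-- The circle on the far side of a cut crossing is not the one through the base end. -/
theorem HasState.not_rel_far (hσ : σ.IsReduced) (hS : σ.HasState S) (hc : σ c = none)
    (hSc : S c = σ.cutType c) : ¬ S.Rel e₀ (c, σ.far e₀ c) := fun h =>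
  hσ.not_rel_far hc (hS.rel_cut hSc h)

/-- Different cut crossings have different circles on their far sides. -/
theorem HasState.far_not_rel_far (hσ : σ.IsReduced) (hS : σ.HasState S) (hcc : c ≠ c')
    (hc : σ c = none) (hc' : σ c' = none) (hSc : S c = σ.cutType c) (hSc' : S c' = σ.cutType c') :
    ¬ S.Rel (c, σ.far e₀ c) (c', σ.far e₀ c') := by
  intro h
  have h1 : ¬ (σ.cut c).Rel e₀ (c', 0) := fun h1 =>
    hσ.not_rel_far hc ((h1.trans (Rel.cross (by rw [cut_apply_of_ne hcc.symm, hc']) _ _)).trans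
      (hS.rel_cut hSc h).symm)
  have h2 := IsReduced.rel_cut_of_rel_cut hcc hc hc' h1 (hσ.rel_near e₀ c)
  exact hσ.not_rel_far hc' ((h2.trans (Rel.cross (by rw [cut_apply_of_ne hcc, hc]) _ _)).trans
      (hS.rel_cut hSc' h))

/-- If the far circle of `c'` is the near circle of `c`, then `c'` separates `c` from the base
end. -/
theorem HasState.weight_lt (hσ : σ.IsReduced) (hS : σ.HasState S) (hcc : c ≠ c')
    (hc : σ c = none) (hc' : σ c' = none) (hSc' : S c' = σ.cutType c')
    (h : S.Rel (c', σ.far e₀ c') (c, σ.near e₀ c)) : σ.weight e₀ c' < σ.weight e₀ c := by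
  classical
  have h1 : ∀ k, ¬ (σ.cut c').Rel e₀ (c, k) := fun k h1 =>
    hσ.not_rel_far hc' ((h1.trans (Rel.cross (by rw [cut_apply_of_ne hcc, hc]) _ _)).trans
      (hS.rel_cut hSc' h).symm)
  refine Finset.card_lt_card (Finset.ssubset_iff_of_subset ?_ |>.mpr
    ⟨(c, σ.near e₀ c), by simpa using hσ.rel_near e₀ c, by simpa using h1 _⟩)
  intro e
  simp only [Finset.mem_filter, Finset.mem_univ, true_and]
  exact IsReduced.rel_cut_of_rel_cut hcc.symm hc' hc (h1 0)

/-- If the crossing `c` is uncut in `S'` and cut in `S`, then `S'` is obtained from `S` by merging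
the circles on both sides of `c`. -/
theorem HasState.isMerge {S' : D.State} (hσ : σ.IsReduced) (hS : σ.HasState S) (hc : σ c = none)
    (hSc : S c = σ.cutType c) (hS' : S' = Function.update S c !σ.cutType c) :
    S.IsMerge S' c := by
  rcases State.isMerge_or_isMerge S S' c _ hSc hS' with h | h
  · exact h
  · exact absurd h.rel (hS.not_rel_zero_two hσ hc hSc)

theorem HasState.update (hS : σ.HasState S) (hc : σ c = none) (b : Bool) :
    σ.HasState (Function.update S c b) := by
  intro c' b' hb
  have hne : c' ≠ c := by rintro rfl; rw [hc] at hb; cases hb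
  rw [Function.update_of_ne hne, hS c' b' hb]

/-- A state in which no crossing of the reduced diagram is cut is a single circle. -/
theorem HasState.rel_of_forall_ne (hσ : σ.IsReduced) (hS : σ.HasState S)
    (h : ∀ c, σ c = none → S c ≠ σ.cutType c) (e e' : D.Ends) : S.Rel e e' := by
  refine (hσ.rel e e').apply_eq (Quot.mk S.toPartial.Adj) (fun a => (State.Rel.edge S a).symm)
    ?_ ?_
  · intro c b hb k
    rw [← hS c b hb]
    exact (State.Rel.partner S c k).symm
  · intro c hc k k'
    have hSc : S c = !σ.cutType c := Bool.eq_not.mpr (h c hc)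
    have hcut : State.IsMerge (Function.update S c (σ.cutType c)) S c := by
      refine HasState.isMerge hσ (hS.update hc (σ.cutType c)) hc (by simp) ?_
      rw [Function.update_idem, ← hSc, Function.update_eq_self]
    exact State.rel_of_rel_zero_two hcut.rel k k'

/-- Every circle of a state of a reduced diagram is the circle through the base end or the circle
on the far side of a cut crossing. -/
theorem HasState.rel_base_or_rel_far (hσ : σ.IsReduced) (hS : σ.HasState S) (e₀ e : D.Ends) :
    S.Rel e e₀ ∨ ∃ c, σ c = none ∧ S c = σ.cutType c ∧ S.Rel e (c, σ.far e₀ c) := by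
  classical
  induction hn : (Finset.univ.filter fun c => σ c = none ∧ S c = σ.cutType c).card
    generalizing S e with
  | zero =>
    rw [Finset.card_eq_zero, Finset.filter_eq_empty_iff] at hn
    exact Or.inl (hS.rel_of_forall_ne hσ (fun c hc h => hn (Finset.mem_univ c) ⟨hc, h⟩) _ _)
  | succ n ih =>
    obtain ⟨c, hmem⟩ := Finset.card_pos.mp (by rw [hn]; exact Nat.succ_pos n)
    obtain ⟨hc, hSc⟩ : σ c = none ∧ S c = σ.cutType c := by simpa using hmem
    have hm := hS.isMerge hσ hc hSc rfl
    have hfilter : (Finset.univ.filter fun a => σ a = none ∧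
        Function.update S c (!σ.cutType c) a = σ.cutType a) =
        (Finset.univ.filter fun a => σ a = none ∧ S a = σ.cutType a).erase c := by
      ext a
      by_cases ha : a = c
      · subst ha; simp
      · simp [ha]
    have ih' := ih (hS.update hc (!σ.cutType c)) e
      (by rw [hfilter, Finset.card_erase_of_mem hmem, hn]; rfl)
    -- A circle which does not reach the far side of `c` persists.
    have key : ∀ z, State.Rel (Function.update S c !σ.cutType c) e z →
        ¬ S.Rel z (c, σ.far e₀ c) → S.Rel e z ∨ S.Rel e (c, σ.far e₀ c) := by
      intro z hz hzf
      rcases hm.rel_iff.mp hz with h | ⟨h1, h2⟩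
      · exact Or.inl h
      · rcases σ.far_near e₀ c with ⟨hf, -⟩ | ⟨hf, -⟩ <;> rw [hf] at hzf ⊢
        · exact h1.symm.imp_left fun h1 => h1.trans (h2.resolve_left hzf).symm
        · exact h1.imp_left fun h1 => h1.trans (h2.resolve_right hzf).symm
    rcases ih' with h | ⟨c', hc', hSc', h⟩
    · refine (key _ h (hS.not_rel_far hσ hc hSc)).imp id fun h => ⟨c, hc, hSc, h⟩
    · have hne : c' ≠ c := by rintro rfl; simp at hSc'
      rw [Function.update_of_ne hne] at hSc'
      refine Or.inr ((key _ h (hS.far_not_rel_far hσ hne hc' hc hSc' hSc)).elim ?_ ?_)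
      · exact fun h => ⟨c', hc', hSc', h⟩
      · exact fun h => ⟨c, hc, hSc, h⟩

end HasState

end PartialState

/-! ### The leaves of the tree -/

namespace PartialState

variable {σ : D.PartialState} {c : Fin D.n}

theorem IsConnected.rel (h : σ.IsConnected) (e e' : D.Ends) : σ.Rel e e' := by
  obtain ⟨h1, -⟩ := Nat.card_eq_one_iff_unique.mp h
  exact Sum.inl_injective (Subsingleton.elim (Sum.inl _ : σ.Components) (Sum.inl _))

theorem isConnected_of_rel [IsEmpty (Fin D.loops)] (e₀ : D.Ends) (h : ∀ e, σ.Rel e e₀) :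
    σ.IsConnected := by
  refine Nat.card_eq_one_iff_unique.mpr ⟨⟨?_⟩, ⟨Sum.inl (Quot.mk _ e₀)⟩⟩
  have h0 : ∀ x : σ.Components, x = Sum.inl (Quot.mk _ e₀) := by
    rintro (x | l)
    · obtain ⟨e, rfl⟩ := Quot.exists_rep x
      exact congrArg Sum.inl (h e)
    · exact isEmptyElim l
  intro x y
  rw [h0 x, h0 y]

/-- A smoothing which connects the two sides of the crossing keeps the diagram connected. -/
theorem IsConnected.update [IsEmpty (Fin D.loops)] (h : σ.IsConnected) {b : Bool}
    (hr : PartialState.Rel (Function.update σ c (some b)) (c, 0) (c, 2)) :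
    PartialState.IsConnected (Function.update σ c (some b)) := by
  refine isConnected_of_rel (c, 0) fun e => ?_
  have hself : ∀ k, PartialState.Rel (Function.update σ c (some b)) (c, k) (c, 0) := by
    have hp : ∀ k, PartialState.Rel (Function.update σ c (some b)) (c, k) (c, partner b k) :=
      Rel.partner (by simp)
    intro k
    fin_cases k
    · exact Rel.refl _ _
    · cases b
      · exact hp 1
      · exact (hp 1).trans hr.symm
    · exact hr.symm
    · cases b
      · exact (hp 3).trans hr.symm
      · exact hp 3
  refine (h.rel e (c, 0)).apply_eq (Quot.mk _) (fun a => (Rel.edge _ a).symm) ?_ ?_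
  · intro a b' ha k
    by_cases hac : a = c
    · subst hac
      exact (hself _).trans (hself _).symm
    · exact (Rel.partner (by rw [Function.update_of_ne hac, ha]) k).symm
  · intro a ha k k'
    by_cases hac : a = c
    · subst hac
      exact (hself _).trans (hself _).symm
    · exact Rel.cross (by rw [Function.update_of_ne hac, ha]) k k'

end PartialState

theorem IsNode.isConnected (hD : D.IsConnected) {k : ℕ} {σ : D.PartialState} (h : IsNode k σ) :
    σ.IsConnected := by
  induction h with
  | root => exact hD
  | branch σ c b _ hconn _ => exact hconn b
  | keep σ c _ _ ih => exact ih

/-- The crossings left unsmoothed in the tree are nugatory, and remain so when other crossings are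
smoothed. -/
theorem IsNode.exists_not_rel [IsEmpty (Fin D.loops)] (hD : D.IsConnected) {k : ℕ}
    {σ : D.PartialState} (h : IsNode k σ) (c : Fin D.n) (hck : c.val < k) (hc : σ c = none) :
    ∃ b, ¬ PartialState.Rel (Function.update σ c (some b)) (c, 0) (c, 2) := by
  induction h with
  | root => omega
  | branch σ c' b hσ _ ih =>
    have hne : c ≠ c' := by rintro rfl; simp at hc
    rw [Function.update_of_ne hne] at hc
    have : c.val ≠ c'.val := fun h => hne (Fin.ext h)
    obtain ⟨b', hb'⟩ := ih (by omega) hc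
    refine ⟨b', fun hr => hb' (hr.mono fun a x ha => ?_)⟩
    by_cases hac : a = c
    · subst hac
      simpa using ha
    · rw [Function.update_of_ne hac] at ha ⊢
      rwa [Function.update_of_ne]
      rintro rfl
      rw [hσ.eq_none a le_rfl] at ha
      cases ha
  | keep σ c' hσ hn ih =>
    by_cases hcc : c = c'
    · subst hcc
      push Not at hn
      obtain ⟨b, hb⟩ := hn
      exact ⟨b, fun hr => hb ((hσ.isConnected hD).update hr)⟩
    · have : c.val ≠ c'.val := fun h => hcc (Fin.ext h)
      exact ih (by omega) hc

theorem IsNode.exists_prefix {m : ℕ} {σ : D.PartialState} (h : IsNode m σ) {k : ℕ} (hk : k ≤ m) :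
    ∃ ρ, IsNode k ρ ∧ ∀ c : Fin D.n, c.val < k → ρ c = σ c := by
  induction h with
  | root => exact ⟨_, by rw [Nat.le_zero.mp hk]; exact IsNode.root, fun _ _ => rfl⟩
  | branch σ c b hσ hconn ih =>
    rcases Nat.lt_or_ge c.val k with h | h
    · obtain rfl : k = c.val + 1 := by omega
      exact ⟨_, IsNode.branch σ c b hσ hconn, fun _ _ => rfl⟩
    · obtain ⟨ρ, hρ, hag⟩ := ih h
      refine ⟨ρ, hρ, fun a ha => ?_⟩
      rw [hag a ha, Function.update_of_ne]
      rintro rfl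
      omega
  | keep σ c hσ hn ih =>
    rcases Nat.lt_or_ge c.val k with h | h
    · obtain rfl : k = c.val + 1 := by omega
      exact ⟨_, IsNode.keep σ c hσ hn, fun _ _ => rfl⟩
    · exact ih h

namespace State

variable {S S' : D.State} {c : Fin D.n}

theorem leaf_mem (S : D.State) : S.leaf ∈ D.leaves := (existsUnique_leaf S).choose_spec.1.1

theorem leaf_hasState (S : D.State) : S.leaf.HasState S := (existsUnique_leaf S).choose_spec.1.2

theorem leaf_eq {σ : D.PartialState} (h : σ ∈ D.leaves) (hS : σ.HasState S) : S.leaf = σ :=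
  (existsUnique_leaf S).unique ⟨S.leaf_mem, S.leaf_hasState⟩ ⟨h, hS⟩

theorem leaf_eq_leaf (h : S.leaf.HasState S') : S'.leaf = S.leaf := leaf_eq S.leaf_mem h

theorem leaf_isReduced [IsEmpty (Fin D.loops)] (hD : D.IsConnected) (S : D.State) :
    S.leaf.IsReduced where
  rel := (IsNode.isConnected hD S.leaf_mem).rel
  exists_not_rel c hc := IsNode.exists_not_rel hD S.leaf_mem c c.isLt hc

theorem hasState_of_eq_off {σ : D.PartialState} (hσ : σ.HasState S) (hc : σ c = none)
    (hS' : ∀ c', c' ≠ c → S' c' = S c') : σ.HasState S' := by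
  intro c' b hb
  rw [hS' c' (by rintro rfl; rw [hc] at hb; cases hb)]
  exact hσ c' b hb

/-- The 1-smoothings of the leaf containing the state `S`, ordered lexicographically. -/
noncomputable def leafCode (S : D.State) : Lex (Fin D.n → Bool) :=
  toLex fun c => decide (S.leaf c = some true)

/-- If changing a 0-smoothing into a 1-smoothing leads to another leaf, then this crossing is the
first one at which the paths to the two leaves differ. -/
theorem leafCode_lt (hc : S c = false) (hS' : S' = Function.update S c true)
    (hne : S.leaf ≠ S'.leaf) : S.leafCode < S'.leafCode := by
  have hoff : ∀ c', c' ≠ c → S' c' = S c' := fun c' h => by rw [hS', Function.update_of_ne h]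
  have hoff' : ∀ c', c' ≠ c → S c' = S' c' := fun c' h => (hoff c' h).symm
  have h1 : S.leaf c = some false := by
    rcases h : S.leaf c with _ | b
    · exact absurd (leaf_eq_leaf (hasState_of_eq_off S.leaf_hasState h hoff)).symm hne
    · rw [← S.leaf_hasState c b h, hc]
  have h2 : S'.leaf c = some true := by
    rcases h : S'.leaf c with _ | b
    · exact absurd (leaf_eq_leaf (hasState_of_eq_off S'.leaf_hasState h hoff')) hne
    · rw [← S'.leaf_hasState c b h, hS', Function.update_self]
  obtain ⟨ρ, hρ, hag⟩ := IsNode.exists_prefix S.leaf_mem c.isLt.le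
  obtain ⟨ρ', hρ', hag'⟩ := IsNode.exists_prefix S'.leaf_mem c.isLt.le
  have hst : ∀ {τ : D.PartialState} {T : D.State}, IsNode c.val τ →
      (∀ a : Fin D.n, a.val < c.val → τ a = T.leaf a) → τ.HasState T := by
    intro τ T hτ hagτ a b hb
    rcases Nat.lt_or_ge a.val c.val with h | h
    · exact T.leaf_hasState a b (by rw [← hagτ a h, hb])
    · rw [hτ.eq_none a h] at hb
      cases hb
  obtain rfl : ρ = ρ' := hρ.unique ρ' hρ' (hst hρ hag)
    (hasState_of_eq_off (hst hρ' hag') (hρ'.eq_none c le_rfl) hoff')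
  refine ⟨c, fun a ha => ?_, ?_⟩
  · change decide (S.leaf a = some true) = decide (S'.leaf a = some true)
    rw [← hag a ha, ← hag' a ha]
  · simp [leafCode, h1, h2]

end State

/-! ### The matching -/

namespace EnhancedState

variable {σ : D.PartialState} {e₀ : D.Ends} {c c' : Fin D.n} {X Y Z W : D.EnhancedState}

/-- The crossing `c` of the reduced diagram `σ` is cut in `X`, and the circle on its far side has
the label which is not cancelled: `v₋` if the cutting smoothing is the 0-smoothing, and `v₊`
if it is the 1-smoothing. -/
def IsCritAt (σ : D.PartialState) (e₀ : D.Ends) (X : D.EnhancedState) (c : Fin D.n) : Prop :=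
  X.state c = σ.cutType c ∧ X.labelAt (c, σ.far e₀ c) = σ.cutType c

/-- The crossing `c` is cut in `Z` and not in `W`, the circle of `Z` on the far side of `c` has the
label which is cancelled, and the other circles have the same labels in `Z` and `W`. -/
structure Mated (σ : D.PartialState) (e₀ : D.Ends) (c : Fin D.n) (Z W : D.EnhancedState) :
    Prop where
  cut : Z.state c = σ.cutType c
  state : W.state = Function.update Z.state c !σ.cutType c
  label_far : Z.labelAt (c, σ.far e₀ c) = !σ.cutType c
  label : ∀ e, ¬ Z.state.Rel e (c, σ.far e₀ c) → W.labelAt e = Z.labelAt e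

theorem through_iff_far_near (S : D.State) (σ : D.PartialState) (e₀ e : D.Ends) (c : Fin D.n) :
    S.Through c e ↔ S.Rel e (c, σ.far e₀ c) ∨ S.Rel e (c, σ.near e₀ c) := by
  rcases σ.far_near e₀ c with ⟨h1, h2⟩ | ⟨h1, h2⟩ <;> rw [h1, h2]
  · rfl
  · exact or_comm

theorem not_rel_near_far (hσ : σ.IsReduced) {S : D.State} (hS : σ.HasState S) (hc : σ c = none)
    (hSc : S c = σ.cutType c) : ¬ S.Rel (c, σ.near e₀ c) (c, σ.far e₀ c) := by
  have h := hS.not_rel_zero_two hσ hc hSc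
  rcases σ.far_near e₀ c with ⟨h1, h2⟩ | ⟨h1, h2⟩ <;> rw [h1, h2]
  · exact fun h' => h h'.symm
  · exact h

namespace Mated

theorem cut' (h : Mated σ e₀ c Z W) : W.state c = !σ.cutType c := by
  rw [h.state, Function.update_self]

theorem off (h : Mated σ e₀ c Z W) (hc : c' ≠ c) : W.state c' = Z.state c' := by
  rw [h.state, Function.update_of_ne hc]

theorem state' (h : Mated σ e₀ c Z W) :
    Z.state = Function.update W.state c (σ.cutType c) := by
  rw [h.state, Function.update_idem, ← h.cut, Function.update_eq_self]

theorem isMerge (h : Mated σ e₀ c Z W) (hσ : σ.IsReduced) (hS : σ.HasState Z.state)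
    (hc : σ c = none) : Z.state.IsMerge W.state c :=
  hS.isMerge hσ hc h.cut h.state

theorem hasState_right (h : Mated σ e₀ c Z W) (hS : σ.HasState Z.state) (hc : σ c = none) :
    σ.HasState W.state := by
  rw [h.state]
  exact hS.update hc _

theorem hasState_left (h : Mated σ e₀ c Z W) (hS : σ.HasState W.state) (hc : σ c = none) :
    σ.HasState Z.state := by
  rw [h.state']
  exact hS.update hc _

theorem right_unique [IsEmpty (Fin D.loops)] (hσ : σ.IsReduced) (hS : σ.HasState Z.state)
    (hc : σ c = none) (h : Mated σ e₀ c Z W) (h' : Mated σ e₀ c Z Y) : W = Y := by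
  refine ext_labelAt (h.state.trans h'.state.symm) fun e => ?_
  by_cases he : Z.state.Rel e (c, σ.far e₀ c)
  · have hm := h.isMerge hσ hS hc
    have hm' := h'.isMerge hσ hS hc
    have hfn : ∀ {V : D.State}, Z.state.IsMerge V c → V.Rel e (c, σ.near e₀ c) := fun hV =>
      hV.rel_iff.mpr (Or.inr ⟨(through_iff_far_near _ σ e₀ _ _).mpr (Or.inl he),
        State.through_self _ _ _⟩)
    have hn := not_rel_near_far (e₀ := e₀) hσ hS hc h.cut
    rw [labelAt_congr (hfn hm), labelAt_congr (hfn hm'), h.label _ hn, h'.label _ hn]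
  · rw [h.label e he, h'.label e he]

theorem left_unique [IsEmpty (Fin D.loops)] (h : Mated σ e₀ c Z W) (h' : Mated σ e₀ c Y W) :
    Z = Y := by
  have hs : Z.state = Y.state := h.state'.trans h'.state'.symm
  refine ext_labelAt hs fun e => ?_
  by_cases he : Z.state.Rel e (c, σ.far e₀ c)
  · rw [labelAt_congr he, h.label_far]
    rw [hs] at he
    rw [labelAt_congr he, h'.label_far]
  · rw [← h.label e he]
    rw [hs] at he
    rw [← h'.label e he]

theorem not_isCritAt_left (h : Mated σ e₀ c Z W) : ¬ IsCritAt σ e₀ Z c := fun h' => by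
  have := h'.2
  rw [h.label_far] at this
  simp at this

theorem not_isCritAt_right (h : Mated σ e₀ c Z W) : ¬ IsCritAt σ e₀ W c := fun h' => by
  have := h'.1
  rw [h.cut'] at this
  simp at this

theorem isCritAt_iff_of_ne (hσ : σ.IsReduced) (hS : σ.HasState Z.state) (hc : σ c = none)
    (hc' : σ c' = none) (hne : c' ≠ c) (h : Mated σ e₀ c Z W) :
    IsCritAt σ e₀ Z c' ↔ IsCritAt σ e₀ W c' := by
  rw [IsCritAt, IsCritAt, h.off hne]
  refine and_congr_right fun hcut => ?_
  rw [h.label _ (hS.far_not_rel_far hσ hne hc' hc hcut h.cut)]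

theorem isCritAt_iff (hσ : σ.IsReduced) (hS : σ.HasState Z.state) (hc : σ c = none)
    (hc' : σ c' = none) (h : Mated σ e₀ c Z W) :
    IsCritAt σ e₀ Z c' ↔ IsCritAt σ e₀ W c' := by
  by_cases hne : c' = c
  · subst hne
    exact iff_of_false h.not_isCritAt_left h.not_isCritAt_right
  · exact isCritAt_iff_of_ne hσ hS hc hc' hne h

theorem label_of_not_through (h : Mated σ e₀ c Z W) (e : D.Ends) (he : ¬ Z.state.Through c e) :
    W.labelAt e = Z.labelAt e :=
  h.label e fun h' => he ((through_iff_far_near _ σ e₀ _ _).mpr (Or.inl h'))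

theorem label_near (hσ : σ.IsReduced) (hS : σ.HasState Z.state) (hc : σ c = none)
    (h : Mated σ e₀ c Z W) : W.labelAt (c, 0) = Z.labelAt (c, σ.near e₀ c) := by
  rw [← h.label _ (not_rel_near_far hσ hS hc h.cut)]
  exact labelAt_congr (State.rel_of_rel_zero_two (h.isMerge hσ hS hc).rel _ _)

/-- Mates are connected by the differential, if the cutting smoothing is the 0-smoothing. -/
theorem coeff_ne_zero_of_false [IsEmpty (Fin D.loops)] (hσ : σ.IsReduced)
    (hS : σ.HasState Z.state) (hc : σ c = none) (h : Mated σ e₀ c Z W)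
    (ht : σ.cutType c = false) : coeff Z W ≠ 0 := by
  have hm := h.isMerge hσ hS hc
  have hs : IsStep Z W c := isStep_iff.mpr
    ⟨h.cut.trans ht, by rw [h.state, ht]; rfl, h.label_of_not_through⟩
  rw [hs.coeff_ne_zero_iff, localCoeff_of_isMerge hm, h.label_near hσ hS hc]
  have hf := h.label_far
  rw [ht] at hf
  rcases σ.far_near e₀ c with ⟨h1, h2⟩ | ⟨h1, h2⟩ <;> rw [h1] at hf <;> rw [h2, hf]
  · cases Z.labelAt (c, 2) <;> decide
  · cases Z.labelAt (c, 0) <;> decide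

/-- Mates are connected by the differential, if the cutting smoothing is the 1-smoothing. -/
theorem coeff_ne_zero_of_true [IsEmpty (Fin D.loops)] (hσ : σ.IsReduced)
    (hS : σ.HasState Z.state) (hc : σ c = none) (h : Mated σ e₀ c Z W)
    (ht : σ.cutType c = true) : coeff W Z ≠ 0 := by
  have hm := h.isMerge hσ hS hc
  have hs : IsStep W Z c := isStep_iff.mpr
    ⟨by rw [h.cut', ht]; rfl, by rw [h.state', ht],
      fun e he => (h.label_of_not_through e (by rwa [← hm.through_iff])).symm⟩
  rw [hs.coeff_ne_zero_iff, localCoeff_of_isMerge' hm, h.label_near hσ hS hc]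
  have hf := h.label_far
  rw [ht] at hf
  rcases σ.far_near e₀ c with ⟨h1, h2⟩ | ⟨h1, h2⟩ <;> rw [h1] at hf <;> rw [h2, hf]
  · cases Z.labelAt (c, 2) <;> decide
  · cases Z.labelAt (c, 0) <;> decide

end Mated

theorem exists_mated_right [IsEmpty (Fin D.loops)] (hσ : σ.IsReduced) (hS : σ.HasState Z.state)
    (hc : σ c = none) (hcut : Z.state c = σ.cutType c)
    (hfar : Z.labelAt (c, σ.far e₀ c) = !σ.cutType c) : ∃ W, Mated σ e₀ c Z W := by
  classical
  have hm := hS.isMerge hσ hc hcut rfl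
  refine ⟨ofEnds (Function.update Z.state c !σ.cutType c) (fun e =>
    if Z.state.Rel e (c, σ.far e₀ c) then Z.labelAt (c, σ.near e₀ c) else Z.labelAt e) ?_,
    hcut, rfl, hfar, fun e he => by rw [labelAt_ofEnds, if_neg he]⟩
  have key : ∀ e, Z.state.Through c e → (if Z.state.Rel e (c, σ.far e₀ c) then
      Z.labelAt (c, σ.near e₀ c) else Z.labelAt e) = Z.labelAt (c, σ.near e₀ c) := by
    intro e he
    rcases (through_iff_far_near _ σ e₀ _ _).mp he with h | h
    · rw [if_pos h]
    · rw [labelAt_congr h, ite_self]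
  intro e e' hr
  rcases hm.rel_iff.mp hr with h | ⟨h1, h2⟩
  · have : Z.state.Rel e (c, σ.far e₀ c) ↔ Z.state.Rel e' (c, σ.far e₀ c) :=
      ⟨h.symm.trans, h.trans⟩
    rw [labelAt_congr h]
    exact if_congr this rfl rfl
  · rw [key e h1, key e' h2]

theorem exists_mated_left [IsEmpty (Fin D.loops)] (hσ : σ.IsReduced) (hS : σ.HasState W.state)
    (hc : σ c = none) (hcut : W.state c = !σ.cutType c) : ∃ Z, Mated σ e₀ c Z W := by
  classical
  have hup : W.state = Function.update (Function.update W.state c (σ.cutType c)) c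
      !σ.cutType c := by
    rw [Function.update_idem, ← hcut, Function.update_eq_self]
  have hm := (hS.update hc (σ.cutType c)).isMerge hσ hc (by simp) hup
  refine ⟨ofEnds (Function.update W.state c (σ.cutType c)) (fun e =>
    if State.Rel (Function.update W.state c (σ.cutType c)) e (c, σ.far e₀ c) then !σ.cutType c
    else W.labelAt e) ?_, Function.update_self .., hup, ?_, fun e he => ?_⟩
  · intro e e' h
    have : State.Rel (Function.update W.state c (σ.cutType c)) e (c, σ.far e₀ c) ↔
        State.Rel (Function.update W.state c (σ.cutType c)) e' (c, σ.far e₀ c) :=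
      ⟨h.symm.trans, h.trans⟩
    rw [labelAt_congr (hm.rel_of_rel h)]
    exact if_congr this rfl rfl
  · rw [labelAt_ofEnds, if_pos (State.Rel.refl _ _)]
  · exact (if_neg he).symm

open Classical in
/-- The contribution of the crossing `c` to the potential: if `X` is critical at `c`, then it is the
weight of `c`, with the sign of the label of the far circle reversed. -/
noncomputable def potAt (σ : D.PartialState) (e₀ : D.Ends) (X : D.EnhancedState)
    (c : Fin D.n) : ℤ :=
  if σ c = none ∧ IsCritAt σ e₀ X c then
    if σ.cutType c then -(σ.weight e₀ c : ℤ) else σ.weight e₀ c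
  else 0

/-- A function of the pairs of mates in a leaf which decreases along the steps of the differential
not connecting mates. -/
noncomputable def pot (σ : D.PartialState) (e₀ : D.Ends) (X : D.EnhancedState) : ℤ :=
  ∑ c, potAt σ e₀ X c

theorem potAt_congr (h : IsCritAt σ e₀ X c ↔ IsCritAt σ e₀ Y c) :
    potAt σ e₀ X c = potAt σ e₀ Y c := by
  classical
  exact if_congr (and_congr_right fun _ => h) rfl rfl

theorem Mated.pot_eq (hσ : σ.IsReduced) (hS : σ.HasState Z.state) (hc : σ c = none)
    (h : Mated σ e₀ c Z W) : pot σ e₀ Z = pot σ e₀ W := by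
  classical
  refine Finset.sum_congr rfl fun c' _ => ?_
  exact if_congr (and_congr_right fun hc' => h.isCritAt_iff hσ hS hc hc') rfl rfl

/-- A step of the differential at the crossing `c` of `σ` from `X` to `Y`, where `Z` and `W` are
`X` and `Y` in the order in which `c` is cut in `Z`. Either `Z` and `W` are mates, or a label `v₊`
on the near side of `c` becomes `v₋`. -/
theorem mated_or_labels (hσ : σ.IsReduced) (hS : σ.HasState Z.state) (hc : σ c = none)
    (hcut : Z.state c = σ.cutType c) (hW : W.state = Function.update Z.state c !σ.cutType c)
    (hlab : ∀ e, ¬ Z.state.Through c e → W.labelAt e = Z.labelAt e)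
    (h0 : σ.cutType c = false →
      mulCoeff (Z.labelAt (c, 0)) (Z.labelAt (c, 2)) (W.labelAt (c, 0)) ≠ 0)
    (h1 : σ.cutType c = true →
      comulCoeff (W.labelAt (c, 0)) (Z.labelAt (c, 0)) (Z.labelAt (c, 2)) ≠ 0) :
    Mated σ e₀ c Z W ∨ (Z.labelAt (c, σ.far e₀ c) = σ.cutType c ∧
      Z.labelAt (c, σ.near e₀ c) = (!σ.cutType c) ∧ W.labelAt (c, 0) = σ.cutType c) := by
  have key : (Z.labelAt (c, σ.far e₀ c) = (!σ.cutType c) ∧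
      W.labelAt (c, 0) = Z.labelAt (c, σ.near e₀ c)) ∨ (Z.labelAt (c, σ.far e₀ c) = σ.cutType c ∧
      Z.labelAt (c, σ.near e₀ c) = (!σ.cutType c) ∧ W.labelAt (c, 0) = σ.cutType c) := by
    have hbool : ∀ t x y w : Bool, (t = false → mulCoeff x y w ≠ 0) →
        (t = true → comulCoeff w x y ≠ 0) →
        ((x = (!t) ∧ w = y) ∨ (x = t ∧ y = (!t) ∧ w = t)) ∧
        ((y = (!t) ∧ w = x) ∨ (y = t ∧ x = (!t) ∧ w = t)) := by decide
    have h := hbool _ _ _ _ h0 h1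
    rcases σ.far_near e₀ c with ⟨hf, hn⟩ | ⟨hf, hn⟩ <;> rw [hf, hn]
    · exact h.1
    · exact h.2
  refine key.imp_left fun hk => ⟨hcut, hW, hk.1, fun e he => ?_⟩
  by_cases ht : Z.state.Through c e
  · have hm := hS.isMerge hσ hc hcut hW
    rw [labelAt_congr (hm.rel_zero_iff.mpr ht), hk.2]
    exact (labelAt_congr (((through_iff_far_near _ σ e₀ _ _).mp ht).resolve_left he)).symm
  · exact hlab e ht

/-- A step which does not connect mates lowers the potential. -/
theorem pot_lt (hσ : σ.IsReduced) (hS : σ.HasState Z.state) (hc : σ c = none)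
    (hcut : Z.state c = σ.cutType c) (hW : W.state = Function.update Z.state c !σ.cutType c)
    (hlab : ∀ e, ¬ Z.state.Through c e → W.labelAt e = Z.labelAt e)
    (hfar : Z.labelAt (c, σ.far e₀ c) = σ.cutType c)
    (hnear : Z.labelAt (c, σ.near e₀ c) = !σ.cutType c)
    (hw : W.labelAt (c, 0) = σ.cutType c) :
    (σ.cutType c = false → pot σ e₀ W < pot σ e₀ Z) ∧
      (σ.cutType c = true → pot σ e₀ Z < pot σ e₀ W) := by
  classical
  have hm := hS.isMerge hσ hc hcut hW
  let s : ℤ := if σ.cutType c then -1 else 1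
  let δ : Fin D.n → ℤ := fun a => s * (potAt σ e₀ W a - potAt σ e₀ Z a)
  have hself : δ c = -(σ.weight e₀ c : ℤ) := by
    have hZ : IsCritAt σ e₀ Z c := ⟨hcut, hfar⟩
    have hW' : ¬ IsCritAt σ e₀ W c := fun h => by
      have := h.1
      rw [hW, Function.update_self] at this
      simp at this
    simp only [δ, s, potAt, hc, hZ, hW', and_self, and_false, if_true, if_false]
    split_ifs <;> ring
  -- Only the crossing whose far circle is the near circle of `c` can compensate this.
  have hother : ∀ a, a ≠ c → δ a ≠ 0 → σ a = none ∧ Z.state a = σ.cutType a ∧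
      Z.state.Rel (a, σ.far e₀ a) (c, σ.near e₀ c) ∧ δ a = σ.weight e₀ a := by
    intro a ha hδ
    have hst : W.state a = Z.state a := by rw [hW, Function.update_of_ne ha]
    by_cases hσa : σ a = none
    · by_cases hcuta : Z.state a = σ.cutType a
      · have hff := hS.far_not_rel_far (e₀ := e₀) hσ ha hσa hc hcuta hcut
        by_cases hr : Z.state.Rel (a, σ.far e₀ a) (c, σ.near e₀ c)
        · refine ⟨hσa, hcuta, hr, ?_⟩
          have hZl : Z.labelAt (a, σ.far e₀ a) = !σ.cutType c := by
            rw [labelAt_congr hr, hnear]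
          have hWl : W.labelAt (a, σ.far e₀ a) = σ.cutType c := by
            rw [← hw]
            exact labelAt_congr (hm.rel_zero_iff.mpr
              ((through_iff_far_near _ σ e₀ _ _).mpr (Or.inr hr)))
          simp only [δ, s, potAt, IsCritAt, hσa, hst, hcuta, hZl, hWl, true_and]
          cases σ.cutType c <;> cases σ.cutType a <;> simp
        · exfalso
          have hl := hlab (a, σ.far e₀ a) fun h =>
            ((through_iff_far_near _ σ e₀ _ _).mp h).elim hff hr
          have : IsCritAt σ e₀ W a ↔ IsCritAt σ e₀ Z a := by rw [IsCritAt, IsCritAt, hst, hl]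
          exact hδ (by simp only [δ, potAt_congr this, sub_self, mul_zero])
      · exact absurd (by simp only [δ, potAt, IsCritAt, hst, hcuta, false_and, and_false,
          if_false, sub_self, mul_zero]) hδ
    · exact absurd (by simp only [δ, potAt, hσa, false_and, if_false, sub_self, mul_zero]) hδ
  have hlt : ∑ a ∈ Finset.univ.erase c, δ a < σ.weight e₀ c := by
    by_cases hex : ∃ a, a ≠ c ∧ δ a ≠ 0
    · obtain ⟨a, ha, hδ⟩ := hex
      obtain ⟨hσa, hcuta, hr, hδa⟩ := hother a ha hδ
      rw [Finset.sum_eq_single a, hδa]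
      · exact_mod_cast hS.weight_lt hσ ha.symm hc hσa hcuta hr
      · intro a' ha' hne
        by_contra hδ'
        obtain ⟨hσa', hcuta', hr', -⟩ := hother a' (Finset.mem_erase.mp ha').1 hδ'
        exact hS.far_not_rel_far hσ hne hσa' hσa hcuta' hcuta (hr'.trans hr.symm)
      · exact fun h => absurd (Finset.mem_erase.mpr ⟨ha, Finset.mem_univ a⟩) h
    · push Not at hex
      rw [Finset.sum_eq_zero fun a ha => hex a (Finset.mem_erase.mp ha).1]
      exact_mod_cast σ.weight_pos e₀ c
  have htot : s * (pot σ e₀ W - pot σ e₀ Z) < 0 := by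
    have : s * (pot σ e₀ W - pot σ e₀ Z) = ∑ a, δ a := by
      rw [pot, pot, ← Finset.sum_sub_distrib, Finset.mul_sum]
    rw [this, ← Finset.add_sum_erase _ δ (Finset.mem_univ c), hself]
    linarith
  constructor <;> intro ht <;> simp [s, ht] at htot <;> linarith

end EnhancedState

/-! ### Pivots and the triangularity of the matching -/

namespace EnhancedState

variable {e₀ : D.Ends} {c c' : Fin D.n} {X Y Z : D.EnhancedState}

/-- The first crossing of the leaf of `X` at which `X` is not critical. -/
structure IsPivot (e₀ : D.Ends) (X : D.EnhancedState) (c : Fin D.n) : Prop where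
  eq_none : X.state.leaf c = none
  not_isCritAt : ¬ IsCritAt X.state.leaf e₀ X c
  isCritAt : ∀ c', c' < c → X.state.leaf c' = none → IsCritAt X.state.leaf e₀ X c'

/-- The enhanced states which are critical at all crossings of their leaves. -/
def IsCritical (e₀ : D.Ends) (X : D.EnhancedState) : Prop :=
  ∀ c, X.state.leaf c = none → IsCritAt X.state.leaf e₀ X c

theorem IsPivot.unique (h : IsPivot e₀ X c) (h' : IsPivot e₀ X c') : c = c' := by
  rcases lt_trichotomy c c' with hlt | heq | hlt
  · exact absurd (h'.isCritAt c hlt h.eq_none) h.not_isCritAt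
  · exact heq
  · exact absurd (h.isCritAt c' hlt h'.eq_none) h'.not_isCritAt

theorem exists_isPivot (h : ¬ IsCritical e₀ X) : ∃ c, IsPivot e₀ X c := by
  classical
  simp only [IsCritical, not_forall] at h
  obtain ⟨c₀, hc₀, hn₀⟩ := h
  obtain ⟨c, hc, hmin⟩ := Finset.exists_min_image
    (Finset.univ.filter fun c => X.state.leaf c = none ∧ ¬ IsCritAt X.state.leaf e₀ X c) id
    ⟨c₀, by simp [hc₀, hn₀]⟩
  simp only [Finset.mem_filter, Finset.mem_univ, true_and, id_eq] at hc hmin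
  refine ⟨c, hc.1, hc.2, fun c' hlt hc' => ?_⟩
  by_contra hn
  exact absurd (hmin c' ⟨hc', hn⟩) hlt.not_ge

theorem IsPivot.congr (h : IsPivot e₀ X c) (hl : Y.state.leaf = X.state.leaf)
    (hcrit : ∀ a, X.state.leaf a = none →
      (IsCritAt X.state.leaf e₀ X a ↔ IsCritAt X.state.leaf e₀ Y a)) : IsPivot e₀ Y c where
  eq_none := by rw [hl]; exact h.eq_none
  not_isCritAt := by rw [hl, ← hcrit c h.eq_none]; exact h.not_isCritAt
  isCritAt a ha hn := by
    rw [hl] at hn ⊢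
    exact (hcrit a hn).mp (h.isCritAt a ha hn)

/-- The enhanced states `X` and `Y` are mates at the crossing `c` in some order. -/
def MatedAt (e₀ : D.Ends) (c : Fin D.n) (X Y : D.EnhancedState) : Prop :=
  Mated X.state.leaf e₀ c X Y ∨ Mated X.state.leaf e₀ c Y X

theorem MatedAt.leaf_eq (hc : X.state.leaf c = none) (h : MatedAt e₀ c X Y) :
    Y.state.leaf = X.state.leaf := by
  rcases h with h | h
  · exact State.leaf_eq_leaf (h.hasState_right X.state.leaf_hasState hc)
  · exact State.leaf_eq_leaf (h.hasState_left X.state.leaf_hasState hc)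

theorem MatedAt.symm (hc : X.state.leaf c = none) (h : MatedAt e₀ c X Y) : MatedAt e₀ c Y X := by
  have hl := h.leaf_eq hc
  rw [MatedAt, hl]
  exact Or.symm h

theorem MatedAt.state_ne (h : MatedAt e₀ c X Y) : Y.state c ≠ X.state c := by
  rcases h with h | h
  · rw [h.cut, h.cut']; simp
  · rw [h.cut, h.cut']; simp

theorem MatedAt.unique [IsEmpty (Fin D.loops)] (hD : D.IsConnected)
    (hc : X.state.leaf c = none) (h : MatedAt e₀ c X Y)
    (h' : MatedAt e₀ c X Z) : Y = Z := by
  rcases h with h | h <;> rcases h' with h' | h'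
  · exact h.right_unique (State.leaf_isReduced hD _) X.state.leaf_hasState hc h'
  · have := h.cut.symm.trans h'.cut'
    simp at this
  · have := h'.cut.symm.trans h.cut'
    simp at this
  · exact h.left_unique h'

theorem MatedAt.isCritAt_iff [IsEmpty (Fin D.loops)] (hD : D.IsConnected)
    (hc : X.state.leaf c = none)
    (h : MatedAt e₀ c X Y) (a : Fin D.n) (ha : X.state.leaf a = none) :
    IsCritAt X.state.leaf e₀ X a ↔ IsCritAt X.state.leaf e₀ Y a := by
  have hr := State.leaf_isReduced hD X.state
  rcases h with h | h
  · exact h.isCritAt_iff hr X.state.leaf_hasState hc ha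
  · exact (h.isCritAt_iff hr (h.hasState_left X.state.leaf_hasState hc) hc ha).symm

theorem MatedAt.pot_eq [IsEmpty (Fin D.loops)] (hD : D.IsConnected) (hc : X.state.leaf c = none)
    (h : MatedAt e₀ c X Y) : pot X.state.leaf e₀ X = pot X.state.leaf e₀ Y := by
  have hr := State.leaf_isReduced hD X.state
  rcases h with h | h
  · exact h.pot_eq hr X.state.leaf_hasState hc
  · exact (h.pot_eq hr (h.hasState_left X.state.leaf_hasState hc) hc).symm

theorem MatedAt.coeff_ne_zero [IsEmpty (Fin D.loops)] (hD : D.IsConnected)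
    (hc : X.state.leaf c = none)
    (h : MatedAt e₀ c X Y) (hX : X.state c = false) : coeff X Y ≠ 0 := by
  have hr := State.leaf_isReduced hD X.state
  rcases h with h | h
  · exact h.coeff_ne_zero_of_false hr X.state.leaf_hasState hc (h.cut.symm.trans hX)
  · have ht : X.state.leaf.cutType c = true := by
      have := h.cut'
      rw [hX] at this
      simpa using this.symm
    exact h.coeff_ne_zero_of_true hr (h.hasState_left X.state.leaf_hasState hc) hc ht

theorem IsPivot.exists_matedAt [IsEmpty (Fin D.loops)] (hD : D.IsConnected) (h : IsPivot e₀ X c) :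
    ∃ Y, MatedAt e₀ c X Y := by
  have hr := State.leaf_isReduced hD X.state
  by_cases hcut : X.state c = X.state.leaf.cutType c
  · have hl : X.labelAt (c, X.state.leaf.far e₀ c) = !X.state.leaf.cutType c :=
      Bool.eq_not.mpr fun h' => h.not_isCritAt ⟨hcut, h'⟩
    obtain ⟨Y, hY⟩ := exists_mated_right hr X.state.leaf_hasState h.eq_none hcut hl
    exact ⟨Y, Or.inl hY⟩
  · obtain ⟨Y, hY⟩ := exists_mated_left (e₀ := e₀) hr X.state.leaf_hasState h.eq_none
      (Bool.eq_not.mpr hcut)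
    exact ⟨Y, Or.inr hY⟩

theorem MatedAt.isPivot [IsEmpty (Fin D.loops)] (hD : D.IsConnected)
    (hp : IsPivot e₀ X c) (h : MatedAt e₀ c X Y) :
    IsPivot e₀ Y c :=
  hp.congr (h.leaf_eq hp.eq_none) (h.isCritAt_iff hD hp.eq_none)

open Classical in
/-- The enhanced state matched with `X`, which differs from it at the pivot of `X`. -/
noncomputable def mate (e₀ : D.Ends) (X : D.EnhancedState) : D.EnhancedState :=
  if h : ∃ Y c, IsPivot e₀ X c ∧ MatedAt e₀ c X Y then h.choose else X

theorem IsPivot.matedAt_mate [IsEmpty (Fin D.loops)] (hD : D.IsConnected) (h : IsPivot e₀ X c) :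
    MatedAt e₀ c X (mate e₀ X) := by
  have hex : ∃ Y c, IsPivot e₀ X c ∧ MatedAt e₀ c X Y := by
    obtain ⟨Y, hY⟩ := h.exists_matedAt hD
    exact ⟨Y, c, h, hY⟩
  rw [mate, dif_pos hex]
  obtain ⟨c', hc', hm⟩ := hex.choose_spec
  rwa [h.unique hc']

theorem mate_eq [IsEmpty (Fin D.loops)] (hD : D.IsConnected)
    (h : IsPivot e₀ X c) (hY : MatedAt e₀ c X Y) :
    mate e₀ X = Y :=
  (h.matedAt_mate hD).unique hD h.eq_none hY

theorem mate_mate [IsEmpty (Fin D.loops)] (hD : D.IsConnected)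
    (h : IsPivot e₀ X c) : mate e₀ (mate e₀ X) = X :=
  mate_eq hD ((h.matedAt_mate hD).isPivot hD h) ((h.matedAt_mate hD).symm h.eq_none)

/-- The enhanced states which are matched with a term of their differential. -/
def sources (e₀ : D.Ends) : Set D.EnhancedState := {X | ∃ c, IsPivot e₀ X c ∧ X.state c = false}

/-- The enhanced states which are matched with an enhanced state in whose differential they
occur. -/
def targets (e₀ : D.Ends) : Set D.EnhancedState := {X | ∃ c, IsPivot e₀ X c ∧ X.state c = true}

theorem isCritical_of_notMem (h : X ∉ sources e₀ ∪ targets e₀) : IsCritical e₀ X := by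
  by_contra hn
  obtain ⟨c, hc⟩ := exists_isPivot hn
  rcases hX : X.state c with _ | _
  · exact h (Or.inl ⟨c, hc, hX⟩)
  · exact h (Or.inr ⟨c, hc, hX⟩)

theorem coeff_mate_ne_zero [IsEmpty (Fin D.loops)] (hD : D.IsConnected) (hX : X ∈ sources e₀) :
    coeff X (mate e₀ X) ≠ 0 := by
  obtain ⟨c, hc, hXc⟩ := hX
  exact (hc.matedAt_mate hD).coeff_ne_zero hD hc.eq_none hXc

theorem mate_mem_sources [IsEmpty (Fin D.loops)] (hD : D.IsConnected) (hX : X ∈ targets e₀) :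
    mate e₀ X ∈ sources e₀ ∧ mate e₀ (mate e₀ X) = X := by
  obtain ⟨c, hc, hXc⟩ := hX
  have hm := hc.matedAt_mate hD
  refine ⟨⟨c, hm.isPivot hD hc, ?_⟩, mate_mate hD hc⟩
  have := hm.state_ne
  rw [hXc] at this
  simpa using this

/-- The order of the matched pairs, which decreases along the differential: by the reverse of the
lexicographic order of the leaves, and inside a leaf by the potential. -/
noncomputable def order (e₀ : D.Ends) (X : D.EnhancedState) :
    (Lex (Fin D.n → Bool))ᵒᵈ ×ₗ ℤ :=
  toLex (OrderDual.toDual X.state.leafCode, pot X.state.leaf e₀ X)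

/-- A term of the differential inside a leaf is the mate, or has a smaller potential. -/
theorem matedAt_or_pot_lt [IsEmpty (Fin D.loops)] (hD : D.IsConnected)
    (hs : IsStep X Y c) (hl : localCoeff X Y c ≠ 0)
    (hc : X.state.leaf c = none) :
    MatedAt e₀ c X Y ∨ pot X.state.leaf e₀ Y < pot X.state.leaf e₀ X := by
  have hr := State.leaf_isReduced hD X.state
  have hS := X.state.leaf_hasState
  obtain ⟨h1, h2, h3⟩ := isStep_iff.mp hs
  rcases ht : X.state.leaf.cutType c with _ | _
  · have hcut : X.state c = X.state.leaf.cutType c := h1.trans ht.symm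
    have hW : Y.state = Function.update X.state c !X.state.leaf.cutType c := by rw [h2, ht]; rfl
    have hm := hS.isMerge hr hc hcut hW
    rw [localCoeff_of_isMerge hm] at hl
    rcases mated_or_labels (e₀ := e₀) hr hS hc hcut hW h3 (fun _ => hl)
      (fun h => by rw [ht] at h; cases h) with h | ⟨hf, hn, hw⟩
    · exact Or.inl (Or.inl h)
    · exact Or.inr ((pot_lt hr hS hc hcut hW h3 hf hn hw).1 ht)
  · have hcut : Y.state c = X.state.leaf.cutType c := by rw [h2, Function.update_self, ht]
    have hW : X.state = Function.update Y.state c !X.state.leaf.cutType c := by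
      rw [h2, Function.update_idem, ht, show (!true) = X.state c by rw [h1]; rfl,
        Function.update_eq_self]
    have hS' : X.state.leaf.HasState Y.state := by
      rw [h2]
      exact hS.update hc _
    have hm := hS'.isMerge hr hc hcut hW
    rw [localCoeff_of_isMerge' hm] at hl
    have h3' : ∀ e, ¬ Y.state.Through c e → X.labelAt e = Y.labelAt e := fun e he =>
      (h3 e (by rwa [hm.through_iff])).symm
    rcases mated_or_labels (e₀ := e₀) hr hS' hc hcut hW h3'
      (fun h => by rw [ht] at h; cases h) (fun _ => hl) with h | ⟨hf, hn, hw⟩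
    · exact Or.inl (Or.inr h)
    · exact Or.inr ((pot_lt hr hS' hc hcut hW h3' hf hn hw).2 ht)

/-- The matrix of the differential between the sources and the targets is triangular. -/
theorem eq_or_order_lt [IsEmpty (Fin D.loops)] (hD : D.IsConnected)
    (hX : X ∈ sources e₀) (hY : Y ∈ sources e₀)
    (h : coeff X (mate e₀ Y) ≠ 0) : X = Y ∨ order e₀ Y < order e₀ X := by
  obtain ⟨c, hs, hl⟩ := exists_isStep_of_coeff_ne_zero h
  obtain ⟨a, hXp, hXa⟩ := hX
  obtain ⟨b, hYp, hYb⟩ := hY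
  have hYm := hYp.matedAt_mate hD
  have hleafY := hYm.leaf_eq hYp.eq_none
  by_cases hleaf : X.state.leaf = (mate e₀ Y).state.leaf
  · have hc : X.state.leaf c = none := by
      rcases hc : X.state.leaf c with _ | t
      · rfl
      · have h1 := X.state.leaf_hasState c t hc
        rw [hleaf] at hc
        have h2 := (mate e₀ Y).state.leaf_hasState c t hc
        rw [hs.2.1, Function.update_self] at h2
        rw [hs.1, ← h2] at h1
        cases h1
    rcases matedAt_or_pot_lt (e₀ := e₀) hD hs hl hc with hm | hlt
    · left
      have hp : IsPivot e₀ (mate e₀ Y) a :=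
        hXp.congr (hm.leaf_eq hc) (hm.isCritAt_iff hD hc)
      obtain rfl : b = a := (hYm.isPivot hD hYp).unique hp
      have hca : c = b := by
        by_contra hne
        have h1 : (mate e₀ Y).state b = X.state b := by
          rw [hs.2.1, Function.update_of_ne (Ne.symm hne)]
        exact hYm.state_ne (h1.trans (hXa.trans hYb.symm))
      subst hca
      exact (hm.symm hc).unique hD (hYm.isPivot hD hYp).eq_none (hYm.symm hYp.eq_none)
    · right
      have hleaf' : Y.state.leaf = X.state.leaf := hleafY.symm.trans hleaf.symm
      rw [order, order, State.leafCode, State.leafCode, hleaf', Prod.Lex.toLex_lt_toLex]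
      refine Or.inr ⟨rfl, ?_⟩
      have hpe := hYm.pot_eq hD hYp.eq_none
      rw [hleaf'] at hpe
      simpa only [hpe] using hlt
  · right
    have hlt := State.leafCode_lt hs.1 hs.2.1 hleaf
    rw [order, order, Prod.Lex.toLex_lt_toLex]
    left
    rwa [show (mate e₀ Y).state.leafCode = Y.state.leafCode by
      rw [State.leafCode, State.leafCode, hleafY]] at hlt

end EnhancedState

/-! ### Critical states and the grading -/

namespace PartialState

variable {σ : D.PartialState} {c : Fin D.n} {e₀ : D.Ends}

/-- The state of a reduced diagram in which no crossing is cut. -/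
noncomputable def baseState (σ : D.PartialState) : D.State := fun c =>
  (σ c).getD !σ.cutType c

theorem baseState_of_none (hc : σ c = none) : σ.baseState c = !σ.cutType c := by
  simp [baseState, hc]

theorem hasState_baseState (σ : D.PartialState) : σ.HasState σ.baseState := by
  intro c b hb
  simp [baseState, hb]

theorem IsReduced.baseState_mem [IsEmpty (Fin D.loops)] (hσ : σ.IsReduced) (e₀ : D.Ends) :
    σ.baseState ∈ D.oneCircleStates :=
  isConnected_of_rel e₀ fun e => σ.hasState_baseState.rel_of_forall_ne hσ
    (fun c hc => by rw [baseState_of_none hc]; simp) e e₀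

/-- At a nugatory crossing, one strand leaves each side of the crossing and one enters it. Hence
the smoothing which respects the orientation is the one which cuts the diagram. -/
theorem IsReduced.out_eq_iff (hσ : σ.IsReduced) (o : σ.Orientation) (hc : σ c = none) :
    o.out (c, 0) = o.out (c, 1) ↔ σ.cutType c = true := by
  classical
  let ε : D.Ends → ℤ := fun e => if o.out e then 1 else -1
  have hε : ∀ e e', o.out e' ≠ o.out e → ε e + ε e' = 0 := by
    intro e e' h
    simp only [ε]
    revert h
    cases o.out e <;> cases o.out e' <;> simp
  let N := Finset.univ.filter fun e => (σ.cut c).Rel e (c, 0)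
  have hN : ∀ e, e ∈ N ↔ (σ.cut c).Rel e (c, 0) := fun e => by simp [N]
  have hmem : ∀ {e e'}, (σ.cut c).Rel e e' → e ∈ N → e' ∈ N := fun h he =>
    (hN _).mpr (h.symm.trans ((hN _).mp he))
  have h1 : ∑ e ∈ N, ε e = 0 :=
    Finset.sum_involution (fun e _ => D.edge e) (fun e _ => hε _ _ (o.out_edge e))
      (fun e _ _ => D.edge_ne e) (fun e he => hmem (Rel.edge _ e) he) (fun e _ => D.edge_edge e)
  have h2 : ∑ e ∈ N with e.1 ≠ c, ε e = 0 := by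
    refine Finset.sum_involution (fun e _ => σ.across e) (fun e _ => hε _ _ (o.out_across e))
      (fun e _ _ => σ.across_ne e) (fun e he => ?_) (fun e _ => σ.across_across e)
    obtain ⟨he, hec⟩ := Finset.mem_filter.mp he
    refine Finset.mem_filter.mpr ⟨hmem ?_ he, hec⟩
    obtain ⟨a, k⟩ := e
    have hcut : σ.cut c a = σ a := cut_apply_of_ne hec
    rcases ha : σ a with _ | b
    · simpa only [across, ha] using Rel.cross (hcut.trans ha) k (k + 2)
    · simpa only [across, ha] using Rel.partner (hcut.trans ha) k
  have h3 : ∑ e ∈ N with e.1 = c, ε e = 0 := by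
    rw [← Finset.sum_filter_add_sum_filter_not N (fun e => e.1 = c), h2, add_zero] at h1
    exact h1
  have h4 : (N.filter fun e => e.1 = c) =
      {(c, 0), (c, LinkDiagram.partner (σ.cutType c) 0)} := by
    have hp := fun k => Rel.partner (σ.cut_apply_self c) k
    have hn2 : ¬ (σ.cut c).Rel (c, 2) (c, 0) := fun h => hσ.not_rel hc h.symm
    have hn2' : ¬ (σ.cut c).Rel (c, LinkDiagram.partner (σ.cutType c) 2) (c, 0) := fun h =>
      hn2 ((hp 2).trans h)
    have h0' := (hp 0).symm
    ext ⟨a, k⟩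
    simp only [Finset.mem_filter, hN, Finset.mem_insert, Finset.mem_singleton, Prod.mk.injEq]
    constructor
    · rintro ⟨hr, rfl⟩
      generalize σ.cutType a = t at hn2'
      cases t <;> fin_cases k <;> simp_all [LinkDiagram.partner]
    · rintro (⟨rfl, rfl⟩ | ⟨rfl, rfl⟩)
      · exact ⟨Rel.refl _ _, rfl⟩
      · exact ⟨h0', rfl⟩
  have h13 := o.out_across (c, 1)
  simp only [across, hc] at h13
  rw [h4] at h3
  rcases ht : σ.cutType c with _ | _
  · rw [ht, show LinkDiagram.partner false 0 = 1 from rfl,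
      Finset.sum_pair (by simp)] at h3
    simp only [ε] at h3
    revert h3
    cases o.out (c, 0) <;> cases o.out (c, 1) <;> simp
  · rw [ht, show LinkDiagram.partner true 0 = 3 from rfl,
      Finset.sum_pair (by simp)] at h3
    have h13' : o.out (c, 3) ≠ o.out (c, 1) := h13
    simp only [ε] at h3
    revert h3 h13'
    cases o.out (c, 0) <;> cases o.out (c, 1) <;> cases o.out (c, 3) <;> simp

/-- The sum of the degrees of the critical labels of the far circles. -/
noncomputable def farDegree (σ : D.PartialState) : ℤ :=
  ∑ c, if σ c = none then EnhancedState.labelDegree (σ.cutType c) else 0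

theorem IsReduced.w_eq (hσ : σ.IsReduced) (o : σ.Orientation) : o.w = σ.farDegree := by
  classical
  rw [Orientation.w, Orientation.x, Orientation.y, Finset.card_filter, Finset.card_filter,
    farDegree]
  push_cast
  rw [← Finset.sum_sub_distrib]
  refine Finset.sum_congr rfl fun c _ => ?_
  by_cases hc : σ c = none
  · have h := hσ.out_eq_iff o hc
    simp only [hc, true_and, if_true, ne_eq, h, EnhancedState.labelDegree]
    cases σ.cutType c <;> simp
  · simp [hc]

end PartialState

theorem State.r_eq_sum (S : D.State) : (S.r : ℤ) = ∑ c, if S c = true then 1 else 0 := by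
  rw [State.r, Finset.card_filter]
  push_cast
  rfl

namespace EnhancedState

variable {e₀ : D.Ends} {X Y : D.EnhancedState}

/-- The primary degree of a critical enhanced state. -/
theorem IsCritical.deg_eq (h : IsCritical e₀ X) :
    X.deg = X.state.leaf.farDegree + X.state.leaf.baseState.r := by
  rw [deg, State.r_eq_sum, State.r_eq_sum, PartialState.farDegree, ← Finset.sum_add_distrib]
  refine Finset.sum_congr rfl fun c _ => ?_
  rcases hc : X.state.leaf c with _ | b
  · rw [(h c hc).1, PartialState.baseState_of_none hc, labelDegree]
    cases X.state.leaf.cutType c <;> simp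
  · rw [X.state.leaf_hasState c b hc, PartialState.hasState_baseState _ c b hc]
    simp

/-- The secondary degree of a critical enhanced state, whose circles are the circle through the base
end and the far circles of the crossings of the leaf. -/
theorem IsCritical.qdeg_eq [IsEmpty (Fin D.loops)] (hD : D.IsConnected) (h : IsCritical e₀ X) :
    X.qdeg = labelDegree (X.labelAt e₀) + X.state.leaf.farDegree + X.deg := by
  classical
  have hr := State.leaf_isReduced hD X.state
  have hS := X.state.leaf_hasState
  let F : Option {c // X.state.leaf c = none} → X.state.Circles := fun a =>
    a.elim (X.state.circle e₀) fun c => X.state.circle (c.1, X.state.leaf.far e₀ c.1)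
  have hF : Function.Bijective F := by
    constructor
    · rintro (_ | c) (_ | c') hcc
      · rfl
      · exact absurd (State.circle_eq_iff.mp hcc) (hS.not_rel_far hr c'.2 (h _ c'.2).1)
      · exact absurd (State.circle_eq_iff.mp hcc).symm (hS.not_rel_far hr c.2 (h _ c.2).1)
      · by_contra hne
        refine hS.far_not_rel_far hr (fun h' => hne ?_) c.2 c'.2 (h _ c.2).1 (h _ c'.2).1
          (State.circle_eq_iff.mp hcc)
        rw [Subtype.ext h']
    · intro C
      obtain ⟨e, rfl⟩ := X.state.circle_surjective C
      rcases hS.rel_base_or_rel_far hr e₀ e with h' | ⟨c, hc, -, h'⟩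
      · exact ⟨none, (State.circle_eq_iff.mpr h').symm⟩
      · exact ⟨some ⟨c, hc⟩, (State.circle_eq_iff.mpr h').symm⟩
  have hsum : ∑ C, labelDegree (X.label C) =
      labelDegree (X.labelAt e₀) + X.state.leaf.farDegree := by
    rw [← Fintype.sum_bijective F hF _ _ fun _ => rfl, Fintype.sum_option]
    congr 1
    rw [PartialState.farDegree, ← Finset.sum_filter,
      ← Finset.sum_subtype_eq_sum_filter]
    refine Finset.sum_bij (fun c _ => ⟨c.1, by simpa using c.2⟩) ?_ ?_ ?_ ?_
    · simp
    · intro a _ b _ hab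
      exact Subtype.ext (congrArg (fun z => z.1) hab)
    · intro b _
      exact ⟨⟨b.1, by simpa using b.2⟩, by simp⟩
    · intro c _
      exact congrArg labelDegree (h c.1 c.2).2
  rw [EnhancedState.qdeg_eq, hsum, deg]

/-- A critical enhanced state is determined by its leaf and the label at the base end. -/
theorem IsCritical.ext [IsEmpty (Fin D.loops)] (hD : D.IsConnected) (hX : IsCritical e₀ X)
    (hY : IsCritical e₀ Y) (hl : X.state.leaf = Y.state.leaf)
    (h0 : X.labelAt e₀ = Y.labelAt e₀) : X = Y := by
  have hs : X.state = Y.state := by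
    funext c
    rcases hc : X.state.leaf c with _ | b
    · rw [(hX c hc).1, (hY c (hl ▸ hc)).1, hl]
    · rw [X.state.leaf_hasState c b hc, Y.state.leaf_hasState c b (hl ▸ hc)]
  refine ext_labelAt hs fun e => ?_
  rcases X.state.leaf_hasState.rel_base_or_rel_far (State.leaf_isReduced hD _) e₀ e with
    h | ⟨c, hc, -, h⟩
  · have h' : Y.state.Rel e e₀ := hs ▸ h
    rw [labelAt_congr h, labelAt_congr h', h0]
  · have h' : Y.state.Rel e (c, Y.state.leaf.far e₀ c) := hs ▸ h
    rw [labelAt_congr h, labelAt_congr h', (hX c hc).2, (hY c (hl ▸ hc)).2, hl]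

end EnhancedState

/-! ### The bound -/

open MatchingBound Module EnhancedState

/-- The bounds for the rank of the homology and of its homogeneous components in terms of the
one-circle states. -/
def HomologyBounds (D : LinkDiagram) : Prop :=
  Module.rank ℚ (ℚ ⊗[ℤ] D.Homology) ≤ ((2 * D.oneCircleStates.ncard : ℕ) : Cardinal) ∧
  ∀ (o : ∀ S : D.State, S.leaf.Orientation) (i j : ℤ),
    Module.rank ℚ (ℚ ⊗[ℤ] D.homologyAt i j) ≤
      (({S ∈ D.oneCircleStates | (o S).w + (S.r : ℤ) = i ∧
        ((S.r : ℤ) = 2 * i - j + 1 ∨ (S.r : ℤ) = 2 * i - j - 1)}.ncard : ℕ) : Cardinal)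

theorem d_single (X Y : D.EnhancedState) : D.d (Pi.single X 1) Y = coeff X Y := by
  rw [d, Matrix.mulVecLin_apply, Matrix.mulVec_single_one, Matrix.col_apply, Matrix.of_apply]

theorem finrank_homology_eq (D : LinkDiagram) :
    finrank ℤ D.Homology = finrank ℤ (homologyOn D.d Set.univ) := by
  have h : homologyOn D.d Set.univ = ⊤ := by
    rw [homologyOn, show supported (Set.univ : Set D.EnhancedState) = ⊤ from
      Submodule.eq_top_iff'.mpr fun f x _ => Set.mem_univ x]
    rw [show (⊤ : Submodule ℤ D.Chain).submoduleOf (LinearMap.ker D.d) = ⊤ from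
      Submodule.comap_top _, Submodule.map_top, Submodule.range_mkQ]
  rw [h, finrank_top]

/-- The set of enhanced states of the given degrees. -/
def bidegree (D : LinkDiagram) (i j : ℤ) : Set D.EnhancedState := {X | X.deg = i ∧ X.qdeg = j}

theorem homologyAt_eq (i j : ℤ) : D.homologyAt i j = homologyOn D.d (D.bidegree i j) := rfl

/-- The bounds follow if the homology is generated by enhanced states which are determined by a
one-circle state and one label, with the appropriate degrees. -/
theorem rank_homology_le_of_critical (C : Set D.EnhancedState) (base : D.EnhancedState → D.State)
    (lab : D.EnhancedState → Bool) (hK : ∀ X ∈ C, base X ∈ D.oneCircleStates)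
    (hinj : ∀ X ∈ C, ∀ Y ∈ C, base X = base Y → lab X = lab Y → X = Y)
    (hdeg : ∀ o : ∀ S : D.State, S.leaf.Orientation, ∀ X ∈ C,
      X.deg = (o (base X)).w + (base X).r ∧
      X.qdeg = labelDegree (lab X) + (o (base X)).w + X.deg)
    (hrank : finrank ℤ (homologyOn D.d Set.univ) ≤ C.ncard)
    (hrank' : ∀ i j, finrank ℤ (homologyOn D.d (D.bidegree i j)) ≤ (D.bidegree i j ∩ C).ncard) :
    HomologyBounds D := by
  constructor
  · rw [rank_rat_tensor, Nat.cast_le, finrank_homology_eq]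
    refine hrank.trans ?_
    rw [mul_comm, show 2 = (Set.univ : Set Bool).ncard by simp, ← Set.ncard_prod]
    refine Set.ncard_le_ncard_of_injOn (fun X => (base X, lab X))
      (fun X hX => ⟨hK X hX, Set.mem_univ _⟩) (fun X hX Y hY h => ?_) (Set.toFinite _)
    exact hinj X hX Y hY (congrArg Prod.fst h) (congrArg Prod.snd h)
  · intro o i j
    rw [rank_rat_tensor, Nat.cast_le, homologyAt_eq]
    refine (hrank' i j).trans (Set.ncard_le_ncard_of_injOn base ?_ ?_ (Set.toFinite _))
    · rintro X ⟨⟨hi, hj⟩, hX⟩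
      obtain ⟨h1, h2⟩ := hdeg o X hX
      refine ⟨hK X hX, by rw [← h1, hi], ?_⟩
      rw [hi] at h1 h2
      rw [hj] at h2
      rcases hl : lab X with _ | _ <;> rw [hl] at h2 <;> simp only [labelDegree] at h2
      · right
        simp at h2
        linarith
      · left
        simp at h2
        linarith
    · rintro X ⟨⟨hi, hj⟩, hX⟩ Y ⟨⟨hi', hj'⟩, hY⟩ h
      refine hinj X hX Y hY h ?_
      have h1 := (hdeg o X hX).2
      have h2 := (hdeg o Y hY).2
      rw [hi, hj] at h1
      rw [hi', hj', ← (h : base X = base Y)] at h2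
      have h3 : labelDegree (lab X) = labelDegree (lab Y) := by linarith
      revert h3
      cases lab X <;> cases lab Y <;> simp [labelDegree]

theorem isEmpty_loops (hD : D.IsConnected) (e₀ : D.Ends) : IsEmpty (Fin D.loops) := by
  obtain ⟨h, -⟩ := Nat.card_eq_one_iff_unique.mp hD
  refine ⟨fun l => ?_⟩
  have := Subsingleton.elim (α := PartialState.Components (fun _ => none : D.PartialState))
    (Sum.inl (Quot.mk _ e₀)) (Sum.inr l)
  cases this

/-- The homology is bounded by the critical enhanced states. -/
theorem finrank_homologyOn_le_critical [IsEmpty (Fin D.loops)] (hD : D.IsConnected) (e₀ : D.Ends)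
    {A₀ A : Set D.EnhancedState} (hA : ∀ X Y, coeff X Y ≠ 0 → (X ∈ A₀ ↔ Y ∈ A)) :
    finrank ℤ (homologyOn D.d A) ≤ (A ∩ {X | IsCritical e₀ X}).ncard := by
  refine (finrank_homologyOn_le (X := sources e₀) (Y := targets e₀) (A₀ := A₀) d_comp_d (mate e₀)
    (order e₀) ?_ ?_ ?_ ?_).trans (Set.ncard_le_ncard ?_ (Set.toFinite _))
  · intro X hX
    rw [d_single]
    exact coeff_mate_ne_zero hD hX
  · intro X hX Y hY h
    rw [d_single] at h
    exact eq_or_order_lt hD hX hY h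
  · intro X hX Y h
    rw [d_single] at h
    exact (hA X Y h).mp hX
  · rintro Y ⟨hY, hYA⟩
    obtain ⟨h1, h2⟩ := mate_mem_sources hD hY
    have h3 := coeff_mate_ne_zero hD h1
    rw [h2] at h3
    exact ⟨mate e₀ Y, ⟨h1, (hA _ _ h3).mpr hYA⟩, h2⟩
  · rintro X ⟨hX, hn⟩
    exact ⟨hX, isCritical_of_notMem hn⟩

theorem rank_homology_le_of_ends (hD : D.IsConnected) (e₀ : D.Ends) : HomologyBounds D := by
  have := isEmpty_loops hD e₀
  have hleaf : ∀ X : D.EnhancedState, X.state.leaf.baseState.leaf = X.state.leaf := fun X =>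
    State.leaf_eq X.state.leaf_mem X.state.leaf.hasState_baseState
  have hw : ∀ (o : ∀ S : D.State, S.leaf.Orientation) (X : D.EnhancedState),
      (o X.state.leaf.baseState).w = X.state.leaf.farDegree := fun o X => by
    rw [(State.leaf_isReduced hD _).w_eq, hleaf]
  refine rank_homology_le_of_critical {X | IsCritical e₀ X} (fun X => X.state.leaf.baseState)
    (fun X => X.labelAt e₀) ?_ ?_ ?_ ?_ ?_
  · exact fun X _ => (State.leaf_isReduced hD _).baseState_mem e₀
  · intro X hX Y hY h h0
    refine hX.ext hD hY ?_ h0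
    rw [← hleaf X, ← hleaf Y]
    exact congrArg State.leaf h
  · intro o X hX
    rw [hw o X]
    exact ⟨hX.deg_eq, hX.qdeg_eq hD⟩
  · have h := finrank_homologyOn_le_critical hD e₀ (A₀ := Set.univ) (A := Set.univ)
      (fun _ _ _ => by simp)
    rwa [Set.univ_inter] at h
  · intro i j
    refine finrank_homologyOn_le_critical hD e₀ (A₀ := D.bidegree (i - 1) j) fun X Y h => ?_
    rw [bidegree, bidegree, Set.mem_ofPred_eq, Set.mem_ofPred_eq, deg_of_coeff_ne_zero h,
      qdeg_of_coeff_ne_zero h, eq_sub_iff_add_eq]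

/-- A connected diagram without crossings is a circle. -/
theorem rank_homology_le_of_isEmpty [IsEmpty (Fin D.n)] (hD : D.IsConnected) :
    HomologyBounds D := by
  classical
  have hone : ∀ S : D.State, Nat.card S.Circles = 1 := fun S => by
    rw [State.Circles, show S.toPartial = fun _ => none from funext isEmptyElim]
    exact hD
  have hr : ∀ S : D.State, S.r = 0 := fun S => by simp [State.r]
  have hd : D.d = 0 := by
    refine LinearMap.ext fun f => funext fun Y => Finset.sum_eq_zero fun X _ => ?_
    change coeff X Y * f X = 0
    simp [coeff]
  have hrank : ∀ A, finrank ℤ (homologyOn D.d A) ≤ (A ∩ Set.univ).ncard := fun A => by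
    have h := finrank_homologyOn_le (f := D.d) (X := ∅) (Y := ∅) (A₀ := ∅) (A := A)
      (by rw [hd, LinearMap.zero_comp]) id (fun _ => (0 : ℕ)) (by simp) (by simp) (by simp)
      (by simp)
    simpa using h
  have hunique : ∀ S : D.State, ∃ C : S.Circles, ∀ C', C' = C := fun S => by
    obtain ⟨h1, ⟨C⟩⟩ := Nat.card_eq_one_iff_unique.mp (hone S)
    exact ⟨C, fun C' => Subsingleton.elim _ _⟩
  choose circ hcirc using hunique
  refine rank_homology_le_of_critical Set.univ (fun X => X.state) (fun X => X.label (circ X.state))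
    (fun X _ => hone X.state) ?_ ?_ ?_ ?_
  · rintro ⟨S, l⟩ - ⟨S', l'⟩ - h h0
    obtain rfl : S = S' := h
    congr 1
    funext C
    rw [hcirc S C]
    exact h0
  · intro o X _
    have hw : (o X.state).w = 0 := by
      simp [PartialState.Orientation.w, PartialState.Orientation.x, PartialState.Orientation.y]
    have hsum : ∑ C, labelDegree (X.label C) = labelDegree (X.label (circ X.state)) :=
      Fintype.sum_eq_single _ fun C hC => absurd (hcirc X.state C) hC
    simp only [qdeg_eq, deg, hr, hw, hsum]
    simp
  · simpa using hrank Set.univ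
  · exact fun i j => hrank _

end LinkDiagram

theorem theorem2p3 (D : LinkDiagram) (hD : D.IsConnected) :
    Module.rank ℚ (ℚ ⊗[ℤ] D.Homology) ≤ ((2 * D.oneCircleStates.ncard : ℕ) : Cardinal) ∧
    ∀ (o : ∀ S : D.State, S.leaf.Orientation) (i j : ℤ),
      Module.rank ℚ (ℚ ⊗[ℤ] D.homologyAt i j) ≤
        (({S ∈ D.oneCircleStates | (o S).w + (S.r : ℤ) = i ∧
          ((S.r : ℤ) = 2 * i - j + 1 ∨ (S.r : ℤ) = 2 * i - j - 1)}.ncard : ℕ) : Cardinal) := by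
  rcases isEmpty_or_nonempty (Fin D.n) with h | ⟨⟨c⟩⟩
  · exact LinkDiagram.rank_homology_le_of_isEmpty hD
  · exact LinkDiagram.rank_homology_le_of_ends hD (c, 0)
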